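/- Let $w_c(y)=\tfrac32\,\mathrm{sech}^2(y/2)$, the homoclinic solution of $w_c''-w_c+w_c^2=0$ on $(0,\infty)$ with $w_c'(0)=0$ and $w_c(y)\to0$ as $y\to\infty$. For $y_0\ge 0$ put $w(y)=w_c(y+y_0)$ and $\mathscr{L}_{y_0}\phi=\phi''-\phi+2w\phi$, and let $y_{0c}=\log(2+\sqrt3)$. For $y_0\neq y_{0c}$ and $f\in\{w,w^2\}$, let $\mathscr{L}_{y_0}^{-1}f$ denote the unique solution $\psi\in C^2([0,\infty))$ of $\mathscr{L}_{y_0}\psi=f$ on $(0,\infty)$, $\psi'(0)=0$, $\psi(y)\to0$ as $y\to\infty$. Define $$\mu_1(y_0)=\frac{2\int_0^\infty w^2}{\int_0^\infty w\mathscr{L}_{y_0}^{-1}w^2+\sqrt{\int_0^\infty w\mathscr{L}_{y_0}^{-1}w\,\int_0^\infty w^2\mathscr{L}_{y_0}^{-1}w^2}},\qquad \mu_2(y_0)=\frac{2\int_0^\infty w^2}{\int_0^\infty w\mathscr{L}_{y_0}^{-1}w^2-\sqrt{\int_0^\infty w\mathscr{L}_{y_0}^{-1}w\,\int_0^\infty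 w^2\mathscr{L}_{y_0}^{-1}w^2}}.$$ For real $\mu$, a number $\lambda\in\mathbb{C}$ is an eigenvalue of the shifted nonlocal eigenvalue problem (NLEP) if there is a nonzero $\phi\in C^2([0,\infty);\mathbb{C})$ with $$\mathscr{L}_{y_0}\phi-\mu\,\frac{\int_0^\infty w\phi}{\int_0^\infty w^2}\,w^2=\lambda\phi\quad(0<y<\infty),\qquad \phi'(0)=0,\qquad \phi(y)\to0\ \text{ as } y\to\infty.$$ **Theorem.** Suppose that either $0\le y_0<y_{0c}$ and $\mu_1(y_0)<\mu<\mu_2(y_0)$, or $y_0>y_{0c}$ and $0\le\mu<\mu_1(y_0)$. Then every eigenvalue $\lambda$ of the shifted NLEP satisfies $\operatorname{Re}\lambda<0$. -/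

import Mathlib

namespace ShiftedNLEP

noncomputable section

/-- The homoclinic profile `w_c(y) = (3/2) sech²(y/2)`, the decaying solution of
`w'' - w + w² = 0`, `w'(0) = 0`. -/
def wc (y : ℝ) : ℝ := 3 / 2 * (1 / Real.cosh (y / 2)) ^ 2

/-- The shifted profile `w(y) = w_c(y + y₀)`. -/
def w (y0 y : ℝ) : ℝ := wc (y + y0)

/-- The critical shift `y₀c = log (2 + √3)`. -/
def y0c : ℝ := Real.log (2 + Real.sqrt 3)

/-- First derivative on the closed half-line `[0, ∞)` (one-sided at `0`). -/
def D {E : Type*} [NormedAddCommGroup E] [NormedSpace ℝ E] (φ : ℝ → E) : ℝ → E :=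
  derivWithin φ (Set.Ici 0)

/-- The operator `L_{y₀} φ = φ'' - φ + 2 w φ` on the half-line, for real- or complex-valued `φ`. -/
def L {E : Type*} [NormedAddCommGroup E] [NormedSpace ℝ E] (y0 : ℝ) (φ : ℝ → E) (y : ℝ) : E :=
  D (D φ) y - φ y + (2 * w y0 y) • φ y

/-- The class of functions on which the half-line problems are posed: `φ` is `C²` on `[0, ∞)`,
`φ'(0) = 0` and `φ(y) → 0` as `y → ∞`. -/
structure Admissible {E : Type*} [NormedAddCommGroup E] [NormedSpace ℝ E] (φ : ℝ → E) :
    Prop where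
  contDiffOn : ContDiffOn ℝ 2 φ (Set.Ici 0)
  neumann : D φ 0 = 0
  decay : Filter.Tendsto φ Filter.atTop (nhds 0)

/-- `ψ` solves `L_{y₀} ψ = f` on `(0, ∞)` with `ψ'(0) = 0` and `ψ → 0` at infinity. -/
def Solves (y0 : ℝ) (f ψ : ℝ → ℝ) : Prop :=
  Admissible ψ ∧ ∀ y, 0 < y → L y0 ψ y = f y

open Classical in
/-- `L_{y₀}⁻¹ f`: the solution `ψ` of `L_{y₀} ψ = f`, `ψ'(0) = 0`, `ψ → 0` at infinity. For
`y₀ ≥ 0`, `y₀ ≠ y₀c` the homogeneous problem has only the trivial solution, so `ψ` is determined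
on `[0, ∞)`, which is all that is used below; `solves_w` and `solves_w_sq` show
that it exists for `f = w` and `f = w²`. -/
def Linv (y0 : ℝ) (f : ℝ → ℝ) : ℝ → ℝ :=
  if h : ∃ ψ, Solves y0 f ψ then h.choose else 0

/-- `∫₀^∞ w²`. -/
def intWW (y0 : ℝ) : ℝ := ∫ y in Set.Ioi (0 : ℝ), w y0 y ^ 2

/-- `∫₀^∞ w L⁻¹ w²`. -/
def intWLinvWW (y0 : ℝ) : ℝ :=
  ∫ y in Set.Ioi (0 : ℝ), w y0 y * Linv y0 (fun z => w y0 z ^ 2) y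

/-- `∫₀^∞ w L⁻¹ w`. -/
def intWLinvW (y0 : ℝ) : ℝ := ∫ y in Set.Ioi (0 : ℝ), w y0 y * Linv y0 (w y0) y

/-- `∫₀^∞ w² L⁻¹ w²`. -/
def intWWLinvWW (y0 : ℝ) : ℝ :=
  ∫ y in Set.Ioi (0 : ℝ), w y0 y ^ 2 * Linv y0 (fun z => w y0 z ^ 2) y

/-- The stability threshold `μ₁(y₀)`. -/
def mu1 (y0 : ℝ) : ℝ :=
  2 * intWW y0 / (intWLinvWW y0 + Real.sqrt (intWLinvW y0 * intWWLinvWW y0))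

/-- The stability threshold `μ₂(y₀)`. -/
def mu2 (y0 : ℝ) : ℝ :=
  2 * intWW y0 / (intWLinvWW y0 - Real.sqrt (intWLinvW y0 * intWWLinvWW y0))

/-- `lam ∈ ℂ` is an eigenvalue of the shifted nonlocal eigenvalue problem
`L_{y₀} φ - μ (∫₀^∞ w φ / ∫₀^∞ w²) w² = lam φ` on `(0, ∞)`, `φ'(0) = 0`, `φ → 0` at infinity. -/
def IsEigenvalue (y0 μ : ℝ) (lam : ℂ) : Prop :=
  ∃ φ : ℝ → ℂ, Admissible φ ∧ (∃ y, 0 ≤ y ∧ φ y ≠ 0) ∧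
    ∀ y, 0 < y →
      L y0 φ y - (μ : ℂ) * ((∫ z in Set.Ioi (0 : ℝ), (w y0 z : ℂ) * φ z) / (intWW y0 : ℂ)) *
        (w y0 y : ℂ) ^ 2 = lam * φ y

/-! The problems defining `L⁻¹ w` and `L⁻¹ w²` are solvable for `y₀ ≠ y₀c`, `y₀ ≥ 0`. -/

/-- The derivative of `w`. -/
def w' (y0 y : ℝ) : ℝ := -(w y0 y * (Real.sinh ((y + y0) / 2) / Real.cosh ((y + y0) / 2)))

lemma hasDerivAt_w (y0 y : ℝ) : HasDerivAt (w y0) (w' y0 y) y := by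
  have hc : Real.cosh ((y + y0) / 2) ≠ 0 := (Real.cosh_pos _).ne'
  have h1 : HasDerivAt (fun y : ℝ => (y + y0) / 2) (1 / 2) y :=
    ((hasDerivAt_id y).add_const y0).div_const 2
  have h2 := (((h1.cosh.fun_inv hc).fun_pow 2).const_mul (3 / 2 : ℝ))
  have h3 : w y0 = fun y => 3 / 2 * ((Real.cosh ((y + y0) / 2))⁻¹) ^ 2 := by
    funext z; simp [w, wc]
  rw [h3]
  refine h2.congr_deriv ?_
  simp only [w', h3]
  generalize Real.sinh ((y + y0) / 2) = S
  generalize Real.cosh ((y + y0) / 2) = C at hc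
  push_cast
  field_simp

lemma hasDerivAt_w' (y0 y : ℝ) : HasDerivAt (w' y0) (w y0 y - w y0 y ^ 2) y := by
  have hc : Real.cosh ((y + y0) / 2) ≠ 0 := (Real.cosh_pos _).ne'
  have h1 : HasDerivAt (fun y : ℝ => (y + y0) / 2) (1 / 2) y :=
    ((hasDerivAt_id y).add_const y0).div_const 2
  have h2 := ((hasDerivAt_w y0 y).fun_mul (h1.sinh.fun_div h1.cosh hc)).fun_neg
  refine h2.congr_deriv ?_
  have hs : Real.sinh ((y + y0) / 2) ^ 2 = Real.cosh ((y + y0) / 2) ^ 2 - 1 := by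
    linarith [Real.cosh_sq ((y + y0) / 2)]
  simp only [w', w, wc]
  field_simp
  simp only [hs]
  ring

lemma contDiff_w (y0 : ℝ) : ContDiff ℝ 2 (w y0) := by
  unfold w wc
  refine contDiff_const.mul (ContDiff.pow (contDiff_const.div ?_ fun y => (Real.cosh_pos _).ne') 2)
  exact Real.contDiff_cosh.comp ((contDiff_id.add contDiff_const).div_const 2)

lemma contDiff_w' (y0 : ℝ) : ContDiff ℝ 2 (w' y0) := by
  unfold w'
  have h : ContDiff ℝ 2 (fun y : ℝ => (y + y0) / 2) :=
    (contDiff_id.add contDiff_const).div_const 2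
  exact ((contDiff_w y0).mul ((Real.contDiff_sinh.comp h).div (Real.contDiff_cosh.comp h)
    fun y => (Real.cosh_pos _).ne')).neg

lemma w_nonneg (y0 y : ℝ) : 0 ≤ w y0 y := by unfold w wc; positivity

lemma w_le (y0 y : ℝ) : w y0 y ≤ 6 * Real.exp (-(y + y0)) := by
  have h1 : Real.exp ((y + y0) / 2) / 2 ≤ Real.cosh ((y + y0) / 2) := by
    rw [Real.cosh_eq]; linarith [Real.exp_pos (-((y + y0) / 2))]
  have h2 : 1 / Real.cosh ((y + y0) / 2) ≤ 2 * Real.exp (-((y + y0) / 2)) := by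
    rw [Real.exp_neg, div_le_iff₀ (Real.cosh_pos _)]
    have := Real.exp_pos ((y + y0) / 2)
    field_simp
    linarith
  have h3 : (1 / Real.cosh ((y + y0) / 2)) ^ 2 ≤ (2 * Real.exp (-((y + y0) / 2))) ^ 2 :=
    pow_le_pow_left₀ (one_div_nonneg.2 (Real.cosh_pos _).le) h2 2
  have h4 : Real.exp (-((y + y0) / 2)) ^ 2 = Real.exp (-(y + y0)) := by
    rw [← Real.exp_nat_mul]; congr 1; push_cast; ring
  rw [mul_pow, h4] at h3
  unfold w wc
  linarith

lemma abs_w'_le (y0 y : ℝ) : |w' y0 y| ≤ w y0 y := by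
  have hc := Real.cosh_pos ((y + y0) / 2)
  have : |Real.sinh ((y + y0) / 2) / Real.cosh ((y + y0) / 2)| ≤ 1 := by
    rw [abs_div, abs_of_pos hc, div_le_one hc]
    exact abs_le_of_sq_le_sq (by linarith [Real.cosh_sq ((y + y0) / 2)]) hc.le
  rw [w', abs_neg, abs_mul, abs_of_nonneg (w_nonneg _ _)]
  exact mul_le_of_le_one_right (w_nonneg _ _) this

lemma tendsto_w (y0 : ℝ) : Filter.Tendsto (w y0) Filter.atTop (nhds 0) := by
  have h : Filter.Tendsto (fun y : ℝ => 6 * Real.exp (-(y + y0))) Filter.atTop (nhds 0) := by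
    simpa using (Real.tendsto_exp_neg_atTop_nhds_zero.comp
      (Filter.tendsto_atTop_add_const_right _ y0 Filter.tendsto_id)).const_mul 6
  exact squeeze_zero (w_nonneg y0) (w_le y0) h

lemma tendsto_w' (y0 : ℝ) : Filter.Tendsto (w' y0) Filter.atTop (nhds 0) :=
  squeeze_zero_norm (abs_w'_le y0) (tendsto_w y0)

lemma tendsto_mul_w' (y0 : ℝ) : Filter.Tendsto (fun y => y * w' y0 y) Filter.atTop (nhds 0) := by
  have h : Filter.Tendsto (fun y : ℝ => 6 * Real.exp (-y0) * (y ^ 1 * Real.exp (-y)))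
      Filter.atTop (nhds 0) := by
    simpa using (Real.tendsto_pow_mul_exp_neg_atTop_nhds_zero 1).const_mul (6 * Real.exp (-y0))
  refine squeeze_zero_norm' ?_ h
  filter_upwards [Filter.eventually_ge_atTop (0 : ℝ)] with y hy
  rw [norm_mul, Real.norm_of_nonneg hy, Real.norm_eq_abs]
  calc y * |w' y0 y| ≤ y * (6 * Real.exp (-(y + y0))) :=
        mul_le_mul_of_nonneg_left ((abs_w'_le y0 y).trans (w_le y0 y)) hy
    _ = 6 * Real.exp (-y0) * (y ^ 1 * Real.exp (-y)) := by
        rw [neg_add, Real.exp_add]; ring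

lemma D_eq {f : ℝ → ℝ} {c y : ℝ} (hy : 0 ≤ y) (h : HasDerivAt f c y) : D f y = c :=
  h.hasDerivWithinAt.derivWithin ((uniqueDiffOn_Ici 0) y hy)

lemma DD_eq {f f' f'' : ℝ → ℝ} (h : ∀ y, HasDerivAt f (f' y) y)
    (h' : ∀ y, HasDerivAt f' (f'' y) y) {y : ℝ} (hy : 0 ≤ y) : D (D f) y = f'' y :=
  ((h' y).hasDerivWithinAt.congr_of_mem (fun z hz => D_eq hz (h z)) hy).derivWithin
    ((uniqueDiffOn_Ici 0) y hy)

/-- `1 ≠ w(0)`, i.e. `w''(0) ≠ 0`, away from the critical shift. -/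
lemma w_zero_ne_one {y0 : ℝ} (h0 : 0 ≤ y0) (hne : y0 ≠ y0c) : w y0 0 - w y0 0 ^ 2 ≠ 0 := by
  intro h
  have hpos : 0 < w y0 0 := by unfold w wc; have := Real.cosh_pos ((0 + y0) / 2); positivity
  have h1 : w y0 0 = 1 := by
    have : w y0 0 * (1 - w y0 0) = 0 := by linarith
    rcases mul_eq_zero.1 this with h | h <;> linarith
  have hc := Real.cosh_pos (y0 / 2)
  have h2 : Real.cosh (y0 / 2) ^ 2 = 3 / 2 := by
    simp only [w, wc, zero_add] at h1
    field_simp at h1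
    linarith
  have h3 : Real.cosh y0 = 2 := by
    have := Real.cosh_two_mul (y0 / 2)
    rw [Real.sinh_sq, h2, mul_div_cancel₀ _ two_ne_zero] at this
    linarith
  have h4 : Real.sinh y0 = Real.sqrt 3 := by
    rw [← Real.sqrt_sq (Real.sinh_nonneg_iff.2 h0), Real.sinh_sq, h3]; norm_num
  exact hne (by rw [y0c, ← h3, ← h4, Real.cosh_add_sinh, Real.log_exp])

/-- `L⁻¹ w² = w - (w'(0) / w''(0)) w'`. -/
theorem solves_w_sq {y0 : ℝ} (h0 : 0 ≤ y0) (hne : y0 ≠ y0c) :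
    Solves y0 (fun z => w y0 z ^ 2)
      (fun y => w y0 y - w' y0 0 / (w y0 0 - w y0 0 ^ 2) * w' y0 y) := by
  have hk := w_zero_ne_one h0 hne
  set k := w' y0 0 / (w y0 0 - w y0 0 ^ 2) with hkdef
  have hmul : k * (w y0 0 - w y0 0 ^ 2) = w' y0 0 := div_mul_cancel₀ _ hk
  have hd : ∀ y, HasDerivAt (fun y => w y0 y - k * w' y0 y)
      ((fun y => w' y0 y - k * (w y0 y - w y0 y ^ 2)) y) y := fun y =>
    (hasDerivAt_w y0 y).sub ((hasDerivAt_w' y0 y).const_mul k)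
  have hd' : ∀ y, HasDerivAt (fun y => w' y0 y - k * (w y0 y - w y0 y ^ 2))
      ((fun y => w y0 y - w y0 y ^ 2 - k * (w' y0 y - 2 * w y0 y * w' y0 y)) y) y := fun y => by
    refine ((hasDerivAt_w' y0 y).sub (((hasDerivAt_w y0 y).sub
      ((hasDerivAt_w y0 y).fun_pow 2)).const_mul k)).congr_deriv ?_
    push_cast; ring
  refine ⟨⟨((contDiff_w y0).sub (contDiff_const.mul (contDiff_w' y0))).contDiffOn, ?_, ?_⟩, ?_⟩
  · rw [D_eq le_rfl (hd 0)]
    linear_combination -hmul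
  · simpa using (tendsto_w y0).sub ((tendsto_w' y0).const_mul k)
  · intro y hy
    rw [L, DD_eq hd hd' hy.le, smul_eq_mul]
    ring

/-- `L⁻¹ w = w + y w' / 2 - (3 w'(0) / (2 w''(0))) w'`. -/
theorem solves_w {y0 : ℝ} (h0 : 0 ≤ y0) (hne : y0 ≠ y0c) :
    Solves y0 (w y0)
      (fun y => w y0 y + 1 / 2 * (y * w' y0 y)
        - 3 / 2 * (w' y0 0 / (w y0 0 - w y0 0 ^ 2)) * w' y0 y) := by
  have hk := w_zero_ne_one h0 hne
  set k := w' y0 0 / (w y0 0 - w y0 0 ^ 2) with hkdef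
  have hmul : k * (w y0 0 - w y0 0 ^ 2) = w' y0 0 := div_mul_cancel₀ _ hk
  have hd : ∀ y, HasDerivAt (fun y => w y0 y + 1 / 2 * (y * w' y0 y) - 3 / 2 * k * w' y0 y)
      ((fun y => 3 / 2 * w' y0 y + 1 / 2 * (y * (w y0 y - w y0 y ^ 2))
        - 3 / 2 * k * (w y0 y - w y0 y ^ 2)) y) y := fun y => by
    refine (((hasDerivAt_w y0 y).add (((hasDerivAt_id' y).fun_mul
      (hasDerivAt_w' y0 y)).const_mul (1 / 2))).sub
        ((hasDerivAt_w' y0 y).const_mul (3 / 2 * k))).congr_deriv ?_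
    ring
  have hg : ∀ y, HasDerivAt (fun y => w y0 y - w y0 y ^ 2)
      (w' y0 y - 2 * w y0 y * w' y0 y) y := fun y => by
    refine ((hasDerivAt_w y0 y).sub ((hasDerivAt_w y0 y).fun_pow 2)).congr_deriv ?_
    push_cast; ring
  have hd' : ∀ y, HasDerivAt (fun y => 3 / 2 * w' y0 y + 1 / 2 * (y * (w y0 y - w y0 y ^ 2))
        - 3 / 2 * k * (w y0 y - w y0 y ^ 2))
      ((fun y => 2 * (w y0 y - w y0 y ^ 2)
        + 1 / 2 * (y * (w' y0 y - 2 * w y0 y * w' y0 y))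
        - 3 / 2 * k * (w' y0 y - 2 * w y0 y * w' y0 y)) y) y := fun y => by
    refine ((((hasDerivAt_w' y0 y).const_mul (3 / 2)).add (((hasDerivAt_id' y).fun_mul
      (hg y)).const_mul (1 / 2))).sub ((hg y).const_mul (3 / 2 * k))).congr_deriv ?_
    ring
  refine ⟨⟨?_, ?_, ?_⟩, ?_⟩
  · exact (((contDiff_w y0).add (contDiff_const.mul (contDiff_id.mul (contDiff_w' y0)))).sub
      (contDiff_const.mul (contDiff_w' y0))).contDiffOn
  · rw [D_eq le_rfl (hd 0)]
    linear_combination -(3 / 2 : ℝ) * hmul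
  · simpa only [mul_zero, add_zero, sub_zero] using ((tendsto_w y0).add ((tendsto_mul_w' y0).const_mul (1 / 2))).sub
      ((tendsto_w' y0).const_mul (3 / 2 * k))
  · intro y hy
    rw [L, DD_eq hd hd' hy.le, smul_eq_mul]
    ring

end

end ShiftedNLEP

/-! Suppose Re λ ≥ 0. The eigenfunction φ is then square integrable with two derivatives
(`memLp_of_accretive`). Testing the equation with φ and taking real parts gives Q(Re φ) + Q(Im φ) ≤
0, where Q(x) = E(x,x) + (μ/∫w²) ∫wx ∫w²x and E is the energy form of -L
(`nonlocalForm_add_nonpos`). Positive definiteness of Q (`nonlocalForm_posDef`) then forces φ = 0.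

Put u = L⁻¹w, v = L⁻¹w², s = μ/(2∫w²). Integration by parts gives ∫wx = -E(u,x) and ∫w²x = -E(v,x),
so Q(x) = E(x,x) + 2s E(u,x) E(v,x) is a rank-two perturbation of E. It is controlled by the Gram
entries E(u,u) = -a, E(u,v) = -b, E(v,v) = -c, and a, b, c are the integrals in μ₁ and μ₂.

The sign of E comes from L w' = 0. With ρ = w''/w' one has f'² + (1-2w)f² = (f'-ρf)² + (ρf²)', so
E(f,f) is nonnegative up to the boundary term -ρ(0)f(0)². For y₀ > y₀c, ρ(0) < 0 and E is positive
definite (`energy_nonneg`); Cauchy–Schwarz then gives Q ≥ (1 - s(b+√(ac))) E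
(`positive_perturbation`). For y₀ < y₀c, E is positive definite on the hyperplane f(0) = 0
(`energy_nonneg_of_apply_zero`), while c > 0 makes v a negative direction. Completing the square
(`lorentzian_perturbation`) leaves the condition 2sb - 1 - s²(b²-ac) = (s(b+√(ac)) - 1)(1 -
s(b-√(ac))) > 0, which holds for μ₁ < μ < μ₂. -/

namespace ShiftedNLEP

open MeasureTheory Set Filter Topology
open scoped RealInnerProductSpace

/-! ### Calculus on the closed half-line -/

section HalfLineCalculus

variable {E : Type*} [NormedAddCommGroup E] [NormedSpace ℝ E] {φ : ℝ → E}

lemma hasDerivAt_D (h : ContDiffOn ℝ 2 φ (Ici 0)) {y : ℝ} (hy : 0 < y) :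
    HasDerivAt φ (D φ y) y :=
  ((h.differentiableOn (by norm_num)) y hy.le).hasDerivWithinAt.hasDerivAt (Ici_mem_nhds hy)

lemma contDiffOn_D (h : ContDiffOn ℝ 2 φ (Ici 0)) : ContDiffOn ℝ 1 (D φ) (Ici 0) :=
  h.derivWithin (uniqueDiffOn_Ici 0) (by norm_num)

lemma hasDerivAt_DD (h : ContDiffOn ℝ 2 φ (Ici 0)) {y : ℝ} (hy : 0 < y) :
    HasDerivAt (D φ) (D (D φ) y) y :=
  (((contDiffOn_D h).differentiableOn (by norm_num)) y hy.le).hasDerivWithinAt.hasDerivAt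
    (Ici_mem_nhds hy)

lemma continuousOn_DD (h : ContDiffOn ℝ 2 φ (Ici 0)) : ContinuousOn (D (D φ)) (Ici 0) :=
  (contDiffOn_D h).continuousOn_derivWithin (uniqueDiffOn_Ici 0) (by norm_num)

lemma monotoneOn_Ici_of_hasDerivAt {f f' : ℝ → ℝ} {a : ℝ} (hc : ContinuousOn f (Ici a))
    (hd : ∀ y, a < y → HasDerivAt f (f' y) y) (hf : ∀ y, a < y → 0 ≤ f' y) :
    MonotoneOn f (Ici a) := by
  refine monotoneOn_of_deriv_nonneg (convex_Ici a) hc ?_ ?_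
  · rw [interior_Ici]
    exact fun y hy => (hd y hy).differentiableAt.differentiableWithinAt
  · rw [interior_Ici]
    intro y hy
    rw [(hd y hy).deriv]
    exact hf y hy

lemma bounded_of_tendsto {F : Type*} [NormedAddCommGroup F] {φ : ℝ → F}
    (hc : ContinuousOn φ (Ici 0)) (ht : Tendsto φ atTop (𝓝 0)) :
    ∃ C, 0 ≤ C ∧ ∀ y, 0 ≤ y → ‖φ y‖ ≤ C := by
  obtain ⟨R, hR⟩ := eventually_atTop.1 (ht.norm.eventually (gt_mem_nhds (by simp : ‖(0 : F)‖ < 1)))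
  obtain ⟨C, hC⟩ := (isCompact_Icc (a := (0 : ℝ)) (b := R)).exists_bound_of_continuousOn
    (hc.mono Icc_subset_Ici_self)
  refine ⟨max C 1, le_max_of_le_right zero_le_one, fun y hy => ?_⟩
  rcases le_total y R with h | h
  · exact (hC y ⟨hy, h⟩).trans (le_max_left _ _)
  · exact (hR y h).le.trans (le_max_right _ _)

end HalfLineCalculus

/-- If `g` stays bounded below `1` eventually, its derivative cannot stay above a positive
constant. -/
lemma not_forall_deriv_ge {g g' : ℝ → ℝ} {a δ : ℝ} (hδ : 0 < δ) (hc : ContinuousOn g (Ici a))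
    (hd : ∀ y, a < y → HasDerivAt g (g' y) y) (ht : Tendsto g atTop (𝓝 0))
    (hg : ∀ y, a < y → δ ≤ g' y) : False := by
  have hm : MonotoneOn (fun y => g y - δ * y) (Ici a) :=
    monotoneOn_Ici_of_hasDerivAt (f' := fun y => g' y - δ * 1)
      (hc.sub (by fun_prop)) (fun y hy => (hd y hy).sub ((hasDerivAt_id' y).const_mul δ))
      (fun y hy => by linarith [hg y hy])
  have h2 : Tendsto (fun y => g a - δ * a + δ * y) atTop atTop :=
    tendsto_atTop_add_const_left _ _ (tendsto_id.const_mul_atTop hδ)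
  obtain ⟨y, hy1, hy2, hy3⟩ := ((ht.eventually (gt_mem_nhds zero_lt_one)).and
    ((h2.eventually_gt_atTop 1).and (eventually_ge_atTop a))).exists
  have := hm self_mem_Ici (mem_Ici.2 hy3) hy3
  simp only at this
  linarith

/-! ### From decay to square integrability -/

section Decay

variable {E : Type*} [NormedAddCommGroup E] [InnerProductSpace ℝ E] {φ : ℝ → E}

/-- Convexity of ‖φ‖², up to an exponentially small error: G = (‖φ‖²)' - 2K e^{-y} is increasing and
cannot become positive, since ‖φ‖² → 0. Hence G converges, G' is integrable, and G' dominates the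
integrand. -/
theorem integrableOn_norm_sq_of_decay (h : ContDiffOn ℝ 2 φ (Ici 0))
    (ht : Tendsto φ atTop (𝓝 0)) {K : ℝ} (hK : 0 ≤ K)
    (hin : ∀ y, 0 < y → ‖φ y‖ ^ 2 - K * Real.exp (-y) ≤ ⟪φ y, D (D φ) y⟫) :
    IntegrableOn (fun y => ‖D φ y‖ ^ 2 + ‖φ y‖ ^ 2) (Ioi 0) := by
  have hcφ : ContinuousOn φ (Ici 0) := h.continuousOn
  have hcD : ContinuousOn (D φ) (Ici 0) := (contDiffOn_D h).continuousOn
  have hexp : ∀ y : ℝ, HasDerivAt (fun y : ℝ => Real.exp (-y)) (-Real.exp (-y)) y := fun y => by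
    simpa using (hasDerivAt_neg y).exp
  set G : ℝ → ℝ := fun y => 2 * ⟪φ y, D φ y⟫ - 2 * K * Real.exp (-y) with hG
  have hGd : ∀ y, 0 < y → HasDerivAt G
      (2 * (⟪φ y, D (D φ) y⟫ + ⟪D φ y, D φ y⟫) - 2 * K * (-Real.exp (-y))) y := fun y hy =>
    (((hasDerivAt_D h hy).inner ℝ (hasDerivAt_DD h hy)).const_mul 2).sub ((hexp y).const_mul _)
  have hGc : ContinuousOn G (Ici 0) :=
    (continuousOn_const.mul (hcφ.inner hcD)).sub (by fun_prop)
  have hge : ∀ y, 0 < y → 2 * (‖D φ y‖ ^ 2 + ‖φ y‖ ^ 2) ≤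
      2 * (⟪φ y, D (D φ) y⟫ + ⟪D φ y, D φ y⟫) - 2 * K * (-Real.exp (-y)) := fun y hy => by
    rw [real_inner_self_eq_norm_sq]
    linarith [hin y hy]
  have hGm : MonotoneOn G (Ici 0) := monotoneOn_Ici_of_hasDerivAt hGc hGd
    fun y hy => le_trans (by positivity) (hge y hy)
  have hG0 : ∀ y, 0 ≤ y → G y ≤ 0 := by
    intro y hy
    by_contra! hpos
    refine not_forall_deriv_ge (g := fun y => ‖φ y‖ ^ 2) (a := y) hpos
      ((hcφ.norm.pow 2).mono (Ici_subset_Ici.2 hy))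
      (fun z hz => (hasDerivAt_D h (hy.trans_lt hz)).norm_sq) (by simpa using ht.norm.pow 2) ?_
    intro z hz
    have h1 := hGm (mem_Ici.2 hy) (mem_Ici.2 (hy.trans hz.le)) hz.le
    have h2 : 0 ≤ 2 * K * Real.exp (-z) := by positivity
    simp only [hG] at h1 ⊢
    linarith
  have hlim : ∃ l, Tendsto G atTop (𝓝 l) := by
    -- G is monotone only on [0, ∞); freezing it to the left of 0 gives a globally monotone
    -- function.
    have hmono : Monotone fun y => G (max y 0) := fun a b hab =>
      hGm (mem_Ici.2 (le_max_right a 0)) (mem_Ici.2 (le_max_right b 0)) (max_le_max_right 0 hab)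
    refine ⟨_, (tendsto_atTop_ciSup hmono ⟨0, ?_⟩).congr' ?_⟩
    · rintro _ ⟨y, rfl⟩
      exact hG0 _ (le_max_right _ _)
    · filter_upwards [eventually_ge_atTop (0 : ℝ)] with y hy
      rw [max_eq_left hy]
  obtain ⟨l, hl⟩ := hlim
  have hint := integrableOn_Ioi_deriv_of_nonneg (hGc 0 self_mem_Ici) (fun y hy => hGd y hy)
    (fun y hy => le_trans (by positivity) (hge y hy)) hl
  refine hint.mono' ?_ ?_
  · exact (((hcD.norm.pow 2).add (hcφ.norm.pow 2)).mono Ioi_subset_Ici_self).aestronglyMeasurable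
      measurableSet_Ioi
  · refine (ae_restrict_iff' measurableSet_Ioi).2 (ae_of_all _ fun y hy => ?_)
    rw [Real.norm_of_nonneg (by positivity)]
    have := hge y hy
    have h3 : 0 ≤ ‖D φ y‖ ^ 2 + ‖φ y‖ ^ 2 := by positivity
    linarith

lemma memLp_of_norm_sq_le {F : Type*} [NormedAddCommGroup F] {φ : ℝ → F}
    (hc : ContinuousOn φ (Ici 0)) {g : ℝ → ℝ} (hg : IntegrableOn g (Ioi 0))
    (hle : ∀ y, 0 < y → ‖φ y‖ ^ 2 ≤ g y) : MemLp φ 2 (volume.restrict (Ioi 0)) := by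
  have hm := (hc.mono Ioi_subset_Ici_self).aestronglyMeasurable (μ := volume) measurableSet_Ioi
  rw [memLp_two_iff_integrable_sq_norm hm]
  refine hg.mono' (hm.norm.pow 2) ((ae_restrict_iff' measurableSet_Ioi).2 (ae_of_all _ ?_))
  intro y hy
  rw [Real.norm_of_nonneg (by positivity)]
  exact hle y hy

theorem memLp_of_decay (h : ContDiffOn ℝ 2 φ (Ici 0))
    (ht : Tendsto φ atTop (𝓝 0)) {K C : ℝ} (hK : 0 ≤ K)
    (hin : ∀ y, 0 < y → ‖φ y‖ ^ 2 - K * Real.exp (-y) ≤ ⟪φ y, D (D φ) y⟫)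
    (hle : ∀ y, 0 < y → ‖D (D φ) y‖ ≤ C * ‖φ y‖ + K * Real.exp (-y)) :
    MemLp φ 2 (volume.restrict (Ioi 0)) ∧ MemLp (D φ) 2 (volume.restrict (Ioi 0)) ∧
      MemLp (D (D φ)) 2 (volume.restrict (Ioi 0)) := by
  have hint := integrableOn_norm_sq_of_decay h ht hK hin
  refine ⟨memLp_of_norm_sq_le h.continuousOn hint fun y _ => by nlinarith [sq_nonneg ‖D φ y‖],
    memLp_of_norm_sq_le (contDiffOn_D h).continuousOn hint fun y _ => by
      nlinarith [sq_nonneg ‖φ y‖], ?_⟩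
  have he : IntegrableOn (fun y : ℝ => Real.exp (-y)) (Ioi 0) := by
    simpa using integrableOn_exp_neg_Ioi 0
  refine memLp_of_norm_sq_le (continuousOn_DD h)
    ((hint.const_mul (2 * C ^ 2)).add (he.const_mul (2 * K ^ 2))) fun y hy => ?_
  have h1 := hle y hy
  have h2 : Real.exp (-y) ≤ 1 := Real.exp_le_one_iff.2 (by linarith)
  have h3 := Real.exp_pos (-y)
  have h4 : ‖D (D φ) y‖ ^ 2 ≤ (C * ‖φ y‖ + K * Real.exp (-y)) ^ 2 :=
    pow_le_pow_left₀ (norm_nonneg _) h1 2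
  have h5 : Real.exp (-y) ^ 2 ≤ Real.exp (-y) := by nlinarith
  have h6 : K ^ 2 * Real.exp (-y) ^ 2 ≤ K ^ 2 * Real.exp (-y) :=
    mul_le_mul_of_nonneg_left h5 (sq_nonneg _)
  have h7 : 0 ≤ C ^ 2 * ‖D φ y‖ ^ 2 := by positivity
  simp only [Pi.add_apply]
  nlinarith [sq_nonneg (C * ‖φ y‖ - K * Real.exp (-y))]

end Decay

/-! ### Rank-two perturbations of quadratic forms -/

section QuadraticForms

variable {V : Type*} [AddCommGroup V] [Module ℝ V]

/-- A rank-two perturbation of a symmetric form with one negative direction. -/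
theorem lorentzian_perturbation (B : V →ₗ[ℝ] V →ₗ[ℝ] ℝ) (hB : ∀ x y, B x y = B y x)
    (l : V →ₗ[ℝ] ℝ) (hl : ∀ x, l x = 0 → 0 ≤ B x x) (u v : V) {a b c s : ℝ}
    (ha : B u u = -a) (hb : B u v = -b) (hc : B v v = -c) (hc0 : 0 < c)
    (hs : 0 < 2 * s * b - 1 - s ^ 2 * (b ^ 2 - a * c)) (x : V) :
    0 ≤ B x x + 2 * s * (B u x * B v x) ∧
      (B x x + 2 * s * (B u x * B v x) = 0 → l x = 0 ∧ B x x ≤ 0) := by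
  have hlv : l v ≠ 0 := fun h => by linarith [hl v h]
  -- The combination l(v) z - l(z) v lies in ker l, where B ≥ 0. Hence B ≥ 0 on the B-orthogonal
  -- complement of v, with control of l.
  have key : ∀ z, B v z = 0 → l z ^ 2 * c ≤ l v ^ 2 * B z z := by
    intro z hz
    have h1 := hl (l v • z - l z • v) (by simp; ring)
    simp only [map_sub, map_smul, LinearMap.sub_apply, LinearMap.smul_apply, smul_eq_mul,
      hB z v, hz, hc] at h1
    linarith
  have hv2 : 0 < l v ^ 2 := by positivity
  have hub := hb
  rw [hB] at hub
  set t : ℝ := -(B v x) / c with htdef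
  have hvx : B v x = -(c * t) := by rw [htdef]; field_simp
  -- Here e = u - (b/c)v is orthogonal to v. For a fixed component t along v, the shift by sct·e
  -- completes the square in the complement of v; B(e,e) = (b²-ac)/c yields the last term of the
  -- condition `hs`.
  set z : V := x - t • v - (s * c * t) • (u - (b / c) • v) with hz
  have hvz : B v z = 0 := by
    simp only [hz, map_sub, map_smul, smul_eq_mul, hub, hc, hvx]
    field_simp
    ring
  have hzz : B x x + 2 * s * (B u x * B v x)
      = c * t ^ 2 * (2 * s * b - 1 - s ^ 2 * (b ^ 2 - a * c)) + B z z := by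
    simp only [hz, map_sub, map_smul, LinearMap.sub_apply, LinearMap.smul_apply, smul_eq_mul, hub,
      hb, hc, ha, hvx, hB x v, hB x u]
    field_simp
    ring
  have hz0 : 0 ≤ B z z := by
    have := key z hvz
    have h2 : 0 ≤ l z ^ 2 * c := by positivity
    exact (mul_nonneg_iff_of_pos_left hv2).1 (h2.trans this)
  have hct : 0 ≤ c * t ^ 2 * (2 * s * b - 1 - s ^ 2 * (b ^ 2 - a * c)) := by positivity
  refine ⟨by rw [hzz]; linarith, fun h0 => ?_⟩
  rw [hzz] at h0
  have h1 : c * t ^ 2 * (2 * s * b - 1 - s ^ 2 * (b ^ 2 - a * c)) = 0 := by linarith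
  have h2 : B z z = 0 := by linarith
  have ht : t = 0 := by
    rcases mul_eq_zero.1 h1 with h | h
    · exact pow_eq_zero_iff two_ne_zero |>.1 ((mul_eq_zero.1 h).resolve_left hc0.ne')
    · exact absurd h hs.ne'
  have hzx : z = x := by simp [hz, ht]
  rw [hzx] at h2 hvz
  refine ⟨?_, h2.le⟩
  have := key x hvz
  rw [h2, mul_zero] at this
  have h3 : l x ^ 2 ≤ 0 := nonpos_of_mul_nonpos_left this hc0
  exact pow_eq_zero_iff two_ne_zero |>.1 (le_antisymm h3 (sq_nonneg _))

/-- A rank-two perturbation of a positive semidefinite form. -/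
theorem positive_perturbation (B : V →ₗ[ℝ] V →ₗ[ℝ] ℝ) (hB : ∀ x y, B x y = B y x)
    (hpos : ∀ x, 0 ≤ B x x) (u v : V) {a b c s : ℝ}
    (ha : B u u = -a) (hb : B u v = -b) (hc : B v v = -c) (hs : 0 ≤ s) (x : V) :
    (1 - s * (b + √(a * c))) * B x x ≤ B x x + 2 * s * (B u x * B v x) := by
  have cs : ∀ y, B y x ^ 2 ≤ B y y * B x x := fun y => by
    have := LinearMap.BilinForm.apply_mul_apply_le_of_forall_zero_le B hpos y x
    rwa [hB x y, ← sq] at this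
  have hub := hb
  rw [hB] at hub
  have ha' : 0 ≤ -a := ha ▸ hpos u
  have hc' : 0 ≤ -c := hc ▸ hpos v
  set p := √(-a) with hp
  set q := √(-c) with hq
  have hp2 : p ^ 2 = -a := Real.sq_sqrt ha'
  have hq2 : q ^ 2 = -c := Real.sq_sqrt hc'
  have hp0 : 0 ≤ p := Real.sqrt_nonneg _
  have hq0 : 0 ≤ q := Real.sqrt_nonneg _
  have hpq : √(a * c) = p * q := by
    rw [hp, hq, ← Real.sqrt_mul ha']; congr 1; ring
  suffices h : -((b + p * q) * B x x) ≤ 2 * (B u x * B v x) by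
    rw [hpq]; nlinarith [mul_le_mul_of_nonneg_left h hs]
  -- If u or v is null for B, Cauchy–Schwarz makes both the product and b vanish.
  rcases (mul_nonneg hp0 hq0).eq_or_lt with h0 | h0
  · have h1 : B u x * B v x = 0 := by
      rcases mul_eq_zero.1 h0.symm with h | h
      · have h2 := cs u
        rw [ha, ← hp2, h] at h2
        have : B u x = 0 := by nlinarith
        rw [this, zero_mul]
      · have h2 := cs v
        rw [hc, ← hq2, h] at h2
        have : B v x = 0 := by nlinarith
        rw [this, mul_zero]
    have h2 := LinearMap.BilinForm.apply_mul_apply_le_of_forall_zero_le B hpos u v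
    have h3 : b = 0 := by
      rw [hub, hb, ha, hc, ← hp2, ← hq2] at h2
      have h4 : p ^ 2 * q ^ 2 = 0 := by rw [← mul_pow, ← h0]; norm_num
      nlinarith
    rw [h1, h3, ← h0]; simp
  · have h1 := cs (q • u - p • v)
    simp only [map_sub, map_smul, LinearMap.sub_apply, LinearMap.smul_apply, smul_eq_mul, ha, hb,
      hc, hub, ← hp2, ← hq2] at h1
    have h2 : (p * q) * -((b + p * q) * B x x) ≤ (p * q) * (2 * (B u x * B v x)) := by
      nlinarith [sq_nonneg (q * B u x + p * B v x)]
    exact le_of_mul_le_mul_left h2 h0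

end QuadraticForms

end ShiftedNLEP

namespace ShiftedNLEP

open MeasureTheory Set Filter Topology

/-! ### Profile bounds, the Neumann space and the energy form -/

noncomputable section

lemma w_pos (y0 y : ℝ) : 0 < w y0 y := by
  unfold w wc; have := Real.cosh_pos ((y + y0) / 2); positivity

lemma w_le_three_halves (y0 y : ℝ) : w y0 y ≤ 3 / 2 := by
  have h1 : 1 / Real.cosh ((y + y0) / 2) ≤ 1 := by
    rw [div_le_one (Real.cosh_pos _)]; exact Real.one_le_cosh _
  have h2 : (1 / Real.cosh ((y + y0) / 2)) ^ 2 ≤ 1 :=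
    pow_le_one₀ (one_div_nonneg.2 (Real.cosh_pos _).le) h1
  unfold w wc
  linarith

lemma abs_one_sub_two_w_le (y0 y : ℝ) : |1 - 2 * w y0 y| ≤ 2 := by
  rw [abs_le]
  constructor <;> linarith [w_pos y0 y, w_le_three_halves y0 y]

lemma memLp_w (y0 : ℝ) : MemLp (w y0) 2 (volume.restrict (Ioi 0)) := by
  have he : IntegrableOn (fun y : ℝ => Real.exp (-y)) (Ioi 0) := by
    simpa using integrableOn_exp_neg_Ioi 0
  refine memLp_of_norm_sq_le (contDiff_w y0).continuous.continuousOn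
    (he.const_mul (9 * Real.exp (-y0))) fun y _ => ?_
  rw [Real.norm_of_nonneg (w_nonneg _ _)]
  have h1 := w_le y0 y
  rw [neg_add, Real.exp_add] at h1
  nlinarith [w_pos y0 y, w_le_three_halves y0 y, Real.exp_pos (-y), Real.exp_pos (-y0)]

lemma memLp_w_sq (y0 : ℝ) : MemLp (fun y => w y0 y ^ 2) 2 (volume.restrict (Ioi 0)) := by
  have h := ((memLp_w y0).integrable_sq).const_mul (9 / 4)
  refine memLp_of_norm_sq_le ((contDiff_w y0).continuous.pow 2).continuousOn h fun y _ => ?_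
  rw [Real.norm_of_nonneg (by positivity)]
  have h2 : w y0 y ^ 2 ≤ 9 / 4 := by nlinarith [w_pos y0 y, w_le_three_halves y0 y]
  nlinarith [sq_nonneg (w y0 y)]

section Linearity

variable {f g : ℝ → ℝ}

lemma D_add {y : ℝ} (hf : ContDiffOn ℝ 1 f (Ici 0)) (hg : ContDiffOn ℝ 1 g (Ici 0))
    (hy : 0 ≤ y) : D (f + g) y = D f y + D g y :=
  derivWithin_add (hf.differentiableOn (by norm_num) y hy) (hg.differentiableOn (by norm_num) y hy)

lemma D_smul {y : ℝ} (c : ℝ) (hf : ContDiffOn ℝ 1 f (Ici 0)) (hy : 0 ≤ y) :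
    D (c • f) y = c * D f y :=
  derivWithin_const_smul c (hf.differentiableOn (by norm_num) y hy)

lemma D_congr {y : ℝ} (h : EqOn f g (Ici 0)) (hy : 0 ≤ y) : D f y = D g y :=
  derivWithin_congr h (h hy)

lemma one_of_two (hf : ContDiffOn ℝ 2 f (Ici 0)) : ContDiffOn ℝ 1 f (Ici 0) :=
  hf.of_le (by norm_num)

lemma DD_add {y : ℝ} (hf : ContDiffOn ℝ 2 f (Ici 0)) (hg : ContDiffOn ℝ 2 g (Ici 0))
    (hy : 0 ≤ y) : D (D (f + g)) y = D (D f) y + D (D g) y := by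
  have h : EqOn (D (f + g)) (D f + D g) (Ici 0) :=
    fun z hz => D_add (one_of_two hf) (one_of_two hg) hz
  rw [D_congr h hy, D_add (contDiffOn_D hf) (contDiffOn_D hg) hy]

lemma DD_smul {y : ℝ} (c : ℝ) (hf : ContDiffOn ℝ 2 f (Ici 0)) (hy : 0 ≤ y) :
    D (D (c • f)) y = c * D (D f) y := by
  have h : EqOn (D (c • f)) (c • D f) (Ici 0) := fun z hz => D_smul c (one_of_two hf) hz
  rw [D_congr h hy, D_smul c (contDiffOn_D hf) hy]

lemma memLp_congr_Ioi (hf : MemLp f 2 (volume.restrict (Ioi 0)))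
    (h : ∀ y, 0 < y → g y = f y) : MemLp g 2 (volume.restrict (Ioi 0)) :=
  (memLp_congr_ae ((ae_restrict_iff' measurableSet_Ioi).2 (ae_of_all _ h))).2 hf

end Linearity

/-- The `C²` functions on the half-line with `f'(0) = 0` which are square integrable together with
their first two derivatives. -/
def neumannSpace : Submodule ℝ (ℝ → ℝ) where
  carrier := {f | ContDiffOn ℝ 2 f (Ici 0) ∧ D f 0 = 0 ∧ MemLp f 2 (volume.restrict (Ioi 0)) ∧
    MemLp (D f) 2 (volume.restrict (Ioi 0)) ∧ MemLp (D (D f)) 2 (volume.restrict (Ioi 0))}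
  add_mem' := by
    rintro f g ⟨f1, f2, f3, f4, f5⟩ ⟨g1, g2, g3, g4, g5⟩
    refine ⟨f1.add g1, ?_, f3.add g3, memLp_congr_Ioi (f4.add g4) fun y hy => ?_,
      memLp_congr_Ioi (f5.add g5) fun y hy => ?_⟩
    · rw [D_add (one_of_two f1) (one_of_two g1) le_rfl, f2, g2, add_zero]
    · exact D_add (one_of_two f1) (one_of_two g1) hy.le
    · exact DD_add f1 g1 hy.le
  zero_mem' := by
    have h1 : ∀ y, D (0 : ℝ → ℝ) y = 0 := fun y => by
      simp [D, Pi.zero_def]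
    have h2 : D (0 : ℝ → ℝ) = 0 := funext h1
    refine ⟨contDiffOn_const, h1 0, MemLp.zero, ?_, ?_⟩
    · rw [h2]; exact MemLp.zero
    · rw [h2, h2]; exact MemLp.zero
  smul_mem' := by
    rintro c f ⟨f1, f2, f3, f4, f5⟩
    refine ⟨f1.const_smul c, ?_, f3.const_smul c,
      memLp_congr_Ioi (f4.const_smul c) fun y hy => ?_,
      memLp_congr_Ioi (f5.const_smul c) fun y hy => ?_⟩
    · rw [D_smul c (one_of_two f1) le_rfl, f2, mul_zero]
    · exact D_smul c (one_of_two f1) hy.le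
    · exact DD_smul c f1 hy.le

lemma integrableOn_mul {f g : ℝ → ℝ} (hf : MemLp f 2 (volume.restrict (Ioi 0)))
    (hg : MemLp g 2 (volume.restrict (Ioi 0))) : IntegrableOn (fun y => f y * g y) (Ioi 0) :=
  hf.integrable_mul hg

lemma integrableOn_potential_mul (y0 : ℝ) {f g : ℝ → ℝ}
    (hf : MemLp f 2 (volume.restrict (Ioi 0))) (hg : MemLp g 2 (volume.restrict (Ioi 0))) :
    IntegrableOn (fun y => (1 - 2 * w y0 y) * (f y * g y)) (Ioi 0) := by
  refine (integrableOn_mul hf hg).bdd_mul (c := 2) ?_ (ae_of_all _ fun y => ?_)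
  · exact (continuous_const.sub (continuous_const.mul
      (contDiff_w y0).continuous)).aestronglyMeasurable
  · exact abs_one_sub_two_w_le y0 y

/-- The integrand of the energy form of `-L`. -/
def energyDensity (y0 : ℝ) (f g : ℝ → ℝ) (y : ℝ) : ℝ :=
  D f y * D g y + (1 - 2 * w y0 y) * (f y * g y)

lemma integrableOn_energyDensity (y0 : ℝ) (f g : neumannSpace) :
    IntegrableOn (energyDensity y0 f g) (Ioi 0) :=
  (integrableOn_mul f.2.2.2.2.1 g.2.2.2.2.1).add
    (integrableOn_potential_mul y0 f.2.2.2.1 g.2.2.2.1)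

/-- The energy form `∫₀^∞ f' g' + (1 - 2 w) f g` of `-L`. -/
def energy (y0 : ℝ) : neumannSpace →ₗ[ℝ] neumannSpace →ₗ[ℝ] ℝ :=
  LinearMap.mk₂ ℝ (fun f g => ∫ y in Ioi (0 : ℝ), energyDensity y0 f g y)
    (fun f g h => by
      rw [← integral_add (integrableOn_energyDensity y0 f h) (integrableOn_energyDensity y0 g h)]
      refine setIntegral_congr_fun measurableSet_Ioi fun y hy => ?_
      simp only [energyDensity, Submodule.coe_add, Pi.add_apply,
        D_add (one_of_two f.2.1) (one_of_two g.2.1) (mem_Ioi.1 hy).le]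
      ring)
    (fun c f h => by
      rw [smul_eq_mul, ← integral_const_mul]
      refine setIntegral_congr_fun measurableSet_Ioi fun y hy => ?_
      simp only [energyDensity, Submodule.coe_smul, Pi.smul_apply, smul_eq_mul,
        D_smul c (one_of_two f.2.1) (mem_Ioi.1 hy).le]
      ring)
    (fun f g h => by
      rw [← integral_add (integrableOn_energyDensity y0 f g) (integrableOn_energyDensity y0 f h)]
      refine setIntegral_congr_fun measurableSet_Ioi fun y hy => ?_
      simp only [energyDensity, Submodule.coe_add, Pi.add_apply,
        D_add (one_of_two g.2.1) (one_of_two h.2.1) (mem_Ioi.1 hy).le]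
      ring)
    (fun c f h => by
      rw [smul_eq_mul, ← integral_const_mul]
      refine setIntegral_congr_fun measurableSet_Ioi fun y hy => ?_
      simp only [energyDensity, Submodule.coe_smul, Pi.smul_apply, smul_eq_mul,
        D_smul c (one_of_two h.2.1) (mem_Ioi.1 hy).le]
      ring)

lemma energy_apply (y0 : ℝ) (f g : neumannSpace) :
    energy y0 f g = ∫ y in Ioi (0 : ℝ), energyDensity y0 f g y := rfl

lemma energy_symm (y0 : ℝ) (f g : neumannSpace) : energy y0 f g = energy y0 g f := by
  rw [energy_apply, energy_apply]
  congr 1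
  funext y
  simp only [energyDensity]
  ring

/-- The product and its derivative are both integrable. This disposes of boundary terms at infinity.
-/
lemma tendsto_mul_zero {f f' g g' : ℝ → ℝ} (hf : ∀ y, 0 < y → HasDerivAt f (f' y) y)
    (hg : ∀ y, 0 < y → HasDerivAt g (g' y) y) (f0 : MemLp f 2 (volume.restrict (Ioi 0)))
    (f1 : MemLp f' 2 (volume.restrict (Ioi 0))) (g0 : MemLp g 2 (volume.restrict (Ioi 0)))
    (g1 : MemLp g' 2 (volume.restrict (Ioi 0))) : Tendsto (fun y => f y * g y) atTop (𝓝 0) :=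
  tendsto_zero_of_hasDerivAt_of_integrableOn_Ioi (a := 0)
    (fun y hy => (hf y hy).fun_mul (hg y hy))
    ((integrableOn_mul f1 g0).add (integrableOn_mul f0 g1)) (integrableOn_mul f0 g0)

lemma integrableOn_mul_L (y0 : ℝ) (f g : neumannSpace) :
    IntegrableOn (fun y => (f : ℝ → ℝ) y * L y0 (g : ℝ → ℝ) y) (Ioi 0) := by
  refine ((integrableOn_mul f.2.2.2.1 g.2.2.2.2.2).sub
    (integrableOn_potential_mul y0 f.2.2.2.1 g.2.2.2.1)).congr (ae_of_all _ fun y => ?_)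
  simp only [L, smul_eq_mul, Pi.sub_apply]
  ring

/-- Integration by parts of (f g')': the boundary term at 0 vanishes by the Neumann condition on g.
-/
theorem integral_mul_L (y0 : ℝ) (f g : neumannSpace) :
    ∫ y in Ioi (0 : ℝ), (f : ℝ → ℝ) y * L y0 (g : ℝ → ℝ) y = -energy y0 f g := by
  have h1 := integral_Ioi_of_hasDerivAt_of_tendsto (a := 0)
    (f := fun y => (f : ℝ → ℝ) y * D (g : ℝ → ℝ) y)
    ((f.2.1.continuousOn.mul (contDiffOn_D g.2.1).continuousOn) 0 self_mem_Ici)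
    (fun y hy => (hasDerivAt_D f.2.1 hy).fun_mul (hasDerivAt_DD g.2.1 hy))
    ((integrableOn_mul f.2.2.2.2.1 g.2.2.2.2.1).add (integrableOn_mul f.2.2.2.1 g.2.2.2.2.2))
    (tendsto_mul_zero (fun y hy => hasDerivAt_D f.2.1 hy) (fun y hy => hasDerivAt_DD g.2.1 hy)
      f.2.2.2.1 f.2.2.2.2.1 g.2.2.2.2.1 g.2.2.2.2.2)
  rw [g.2.2.1, mul_zero, sub_zero] at h1
  rw [eq_neg_iff_add_eq_zero, energy_apply,
    ← integral_add (integrableOn_mul_L y0 f g) (integrableOn_energyDensity y0 f g)]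
  refine (integral_congr_ae (ae_of_all _ fun y => ?_)).trans h1
  simp only [L, energyDensity, smul_eq_mul]
  ring

/-! ### Positivity of the energy form -/

/-- The first integral of w'' = w - w²; it gives the limit of `riccati` at infinity. -/
lemma w'_sq (y0 y : ℝ) : w' y0 y ^ 2 = w y0 y ^ 2 * (1 - 2 / 3 * w y0 y) := by
  have hc : Real.cosh ((y + y0) / 2) ≠ 0 := (Real.cosh_pos _).ne'
  have hs := Real.sinh_sq ((y + y0) / 2)
  simp only [w', w, wc]
  field_simp
  rw [hs]

lemma w'_neg {y0 y : ℝ} (h : 0 < y + y0) : w' y0 y < 0 := by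
  have h1 := w_pos y0 y
  have h2 : 0 < Real.sinh ((y + y0) / 2) := Real.sinh_pos_iff.2 (by linarith)
  have h3 := Real.cosh_pos ((y + y0) / 2)
  have : 0 < w y0 y * (Real.sinh ((y + y0) / 2) / Real.cosh ((y + y0) / 2)) := by positivity
  simpa [w'] using this

/-- The logarithmic derivative `w'' / w'` of the solution `w'` of `L w' = 0`. -/
def riccati (y0 y : ℝ) : ℝ := (w y0 y - w y0 y ^ 2) / w' y0 y

lemma hasDerivAt_w'' (y0 y : ℝ) :
    HasDerivAt (fun y => w y0 y - w y0 y ^ 2) ((1 - 2 * w y0 y) * w' y0 y) y := by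
  refine ((hasDerivAt_w y0 y).fun_sub ((hasDerivAt_w y0 y).fun_pow 2)).congr_deriv ?_
  push_cast; ring

lemma hasDerivAt_riccati {y0 y : ℝ} (h : 0 < y + y0) :
    HasDerivAt (riccati y0) (1 - 2 * w y0 y - riccati y0 y ^ 2) y := by
  have hw := (w'_neg h).ne
  refine ((hasDerivAt_w'' y0 y).fun_div (hasDerivAt_w' y0 y) hw).congr_deriv ?_
  simp only [riccati]
  field_simp

lemma tendsto_riccati {y0 : ℝ} (h0 : 0 ≤ y0) : Tendsto (riccati y0) atTop (𝓝 (-1)) := by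
  have h1 : Tendsto (fun y => (1 - w y0 y) / -√(1 - 2 / 3 * w y0 y)) atTop (𝓝 (-1)) := by
    have h2 : Tendsto (fun y => -√(1 - 2 / 3 * w y0 y)) atTop (𝓝 (-√(1 - 2 / 3 * 0))) :=
      (((tendsto_w y0).const_mul (2 / 3)).const_sub 1).sqrt.neg
    have h3 := ((tendsto_w y0).const_sub 1).div h2 (by norm_num)
    simpa [Pi.div_def] using h3
  refine h1.congr' ?_
  filter_upwards [eventually_gt_atTop (0 : ℝ)] with y hy
  have hw := w_pos y0 y
  have h2 : w' y0 y = -(w y0 y * √(1 - 2 / 3 * w y0 y)) := by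
    have h3 := w'_neg (y0 := y0) (y := y) (by linarith)
    have h4 : √(w' y0 y ^ 2) = -w' y0 y := by rw [Real.sqrt_sq_eq_abs, abs_of_neg h3]
    rw [w'_sq, Real.sqrt_mul (sq_nonneg _), Real.sqrt_sq hw.le] at h4
    linarith
  have h5 : 0 < √(1 - 2 / 3 * w y0 y) := by
    have h3 := w'_neg (y0 := y0) (y := y) (by linarith)
    rw [h2] at h3
    by_contra! h
    have := mul_nonpos_of_nonneg_of_nonpos hw.le h
    linarith
  rw [riccati, h2]
  field_simp

/-- Completing the square in the energy with the help of the solution `w'` of `L w' = 0`. -/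
theorem energy_nonneg_of_tendsto {y0 : ℝ} (h0 : 0 ≤ y0) (hne : y0 ≠ y0c) (f : neumannSpace) {m : ℝ}
    (hm : m ≤ 0)
    (hlim : Tendsto (fun y => riccati y0 y * (f : ℝ → ℝ) y ^ 2) (𝓝[>] 0) (𝓝 m)) :
    0 ≤ energy y0 f f ∧ (energy y0 f f ≤ 0 → ∀ y, 0 < y → (f : ℝ → ℝ) y = 0) := by
  have hfc : ContinuousOn (f : ℝ → ℝ) (Ici 0) := f.2.1.continuousOn
  have hDc : ContinuousOn (D (f : ℝ → ℝ)) (Ici 0) := (contDiffOn_D f.2.1).continuousOn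
  have hint := integrableOn_energyDensity y0 f f
  have hqc : ContinuousOn (energyDensity y0 f f) (Ici 0) :=
    (hDc.mul hDc).add ((continuous_const.sub (continuous_const.mul
      (contDiff_w y0).continuous)).continuousOn.mul (hfc.mul hfc))
  have hii : ∀ y, 0 ≤ y → IntervalIntegrable (energyDensity y0 f f) volume 0 y := fun y hy =>
    (intervalIntegrable_iff_integrableOn_Ioc_of_le hy).2 (hint.mono_set Ioc_subset_Ioi_self)
  -- By the Riccati equation ρ' = 1 - 2w - ρ², N' = (f' - ρf)². So N increases from -m ≥ 0 at 0 to
  -- E(f,f) at infinity.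
  set N : ℝ → ℝ := fun y => (∫ x in (0 : ℝ)..y, energyDensity y0 f f x)
    - riccati y0 y * (f : ℝ → ℝ) y ^ 2 with hN
  have hNd : ∀ y, 0 < y →
      HasDerivAt N ((D (f : ℝ → ℝ) y - riccati y0 y * (f : ℝ → ℝ) y) ^ 2) y := by
    intro y hy
    have h1 : HasDerivAt (fun y => ∫ x in (0 : ℝ)..y, energyDensity y0 f f x)
        (energyDensity y0 f f y) y :=
      intervalIntegral.integral_hasDerivAt_right (hii y hy.le)
        ((hqc.mono Ioi_subset_Ici_self).stronglyMeasurableAtFilter isOpen_Ioi y hy)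
        (hqc.continuousAt (Ici_mem_nhds hy))
    refine (h1.fun_sub ((hasDerivAt_riccati (by linarith)).fun_mul
      ((hasDerivAt_D f.2.1 hy).fun_pow 2))).congr_deriv ?_
    simp only [energyDensity]
    push_cast
    ring
  have hmono : MonotoneOn N (Ioi 0) := by
    refine monotoneOn_of_deriv_nonneg (convex_Ioi 0)
      (fun y hy => (hNd y hy).continuousAt.continuousWithinAt) ?_ ?_
    · rw [interior_Ioi]
      exact fun y hy => (hNd y hy).differentiableAt.differentiableWithinAt
    · rw [interior_Ioi]
      intro y hy
      rw [(hNd y hy).deriv]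
      positivity
  have hf0 : Tendsto (fun y => (f : ℝ → ℝ) y * (f : ℝ → ℝ) y) atTop (𝓝 0) :=
    tendsto_mul_zero (fun y hy => hasDerivAt_D f.2.1 hy) (fun y hy => hasDerivAt_D f.2.1 hy)
      f.2.2.2.1 f.2.2.2.2.1 f.2.2.2.1 f.2.2.2.2.1
  have htop : Tendsto N atTop (𝓝 (energy y0 f f)) := by
    have := (intervalIntegral_tendsto_integral_Ioi 0 hint tendsto_id).sub
      ((tendsto_riccati h0).mul hf0)
    simp only [mul_zero, sub_zero, ← sq, id] at this
    exact this
  have hbot : Tendsto N (𝓝[>] 0) (𝓝 (-m)) := by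
    have h1 := intervalIntegral.continuousOn_primitive_interval' (hii 1 zero_le_one) left_mem_uIcc
      0 left_mem_uIcc
    have h2 : Tendsto (fun y => ∫ x in (0 : ℝ)..y, energyDensity y0 f f x) (𝓝[>] 0) (𝓝 0) := by
      have h3 : 𝓝[>] (0 : ℝ) ≤ 𝓝[uIcc 0 1] 0 := by
        rw [uIcc_of_le zero_le_one, ← nhdsWithin_Ioo_eq_nhdsGT zero_lt_one]
        exact nhdsWithin_mono _ Ioo_subset_Icc_self
      simpa using h1.tendsto.mono_left h3
    simpa using h2.sub hlim
  have hle : ∀ y, 0 < y → N y ≤ energy y0 f f := fun y hy => by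
    refine ge_of_tendsto htop ?_
    filter_upwards [eventually_ge_atTop y] with z hz
    exact hmono hy (hy.trans_le hz) hz
  have hge : ∀ y, 0 < y → -m ≤ N y := fun y hy => by
    refine le_of_tendsto hbot ?_
    filter_upwards [Ioo_mem_nhdsGT hy] with z hz
    exact hmono hz.1 hy hz.2.le
  refine ⟨by linarith [hle 1 one_pos, hge 1 one_pos], fun he => ?_⟩
  have hN0 : ∀ y, 0 < y → N y = 0 := fun y hy => by
    have h1 := hle y hy
    have h2 := hge y hy
    linarith
  -- In the equality case N is constant, so f' = ρf and f is a multiple C w' of w'.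
  have hode : ∀ y, 0 < y → D (f : ℝ → ℝ) y = riccati y0 y * (f : ℝ → ℝ) y := by
    intro y hy
    have h1 : HasDerivAt N 0 y := (hasDerivAt_const y (0 : ℝ)).congr_of_eventuallyEq
      (by filter_upwards [Ioi_mem_nhds hy] with z hz using hN0 z hz)
    have h2 := (hNd y hy).unique h1
    have := pow_eq_zero_iff two_ne_zero |>.1 h2
    linarith
  have hw : ∀ y, 0 < y → w' y0 y ≠ 0 := fun y hy => (w'_neg (by linarith)).ne
  have hquot : ∀ y, 0 < y → HasDerivAt (fun y => (f : ℝ → ℝ) y / w' y0 y) 0 y := by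
    intro y hy
    refine ((hasDerivAt_D f.2.1 hy).fun_div (hasDerivAt_w' y0 y) (hw y hy)).congr_deriv ?_
    have h1 := hw y hy
    rw [hode y hy, riccati]
    field_simp
    ring
  obtain ⟨C, hC⟩ : ∃ C, ∀ y, 0 < y → (f : ℝ → ℝ) y = C * w' y0 y := by
    refine ⟨(f : ℝ → ℝ) 1 / w' y0 1, fun y hy => ?_⟩
    have h1 := isOpen_Ioi.is_const_of_deriv_eq_zero (s := Ioi (0 : ℝ)) isPreconnected_Ioi
      (f := fun y => (f : ℝ → ℝ) y / w' y0 y)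
      (fun z hz => (hquot z hz).differentiableAt.differentiableWithinAt)
      (fun z hz => (hquot z hz).deriv) hy (mem_Ioi.2 one_pos)
    rw [← h1, div_mul_cancel₀ _ (hw y hy)]
  -- The Neumann condition reads C w''(0) = 0, and w''(0) ≠ 0 away from the critical shift.
  have hC0 : C * (w y0 0 - w y0 0 ^ 2) = 0 := by
    have h1 : Tendsto (D (f : ℝ → ℝ)) (𝓝[>] 0) (𝓝 0) := by
      have := (hDc 0 self_mem_Ici).tendsto
      rw [f.2.2.1] at this
      exact this.mono_left (nhdsWithin_mono _ Ioi_subset_Ici_self)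
    have h2 : Tendsto (fun y => C * (w y0 y - w y0 y ^ 2)) (𝓝[>] 0)
        (𝓝 (C * (w y0 0 - w y0 0 ^ 2))) :=
      ((hasDerivAt_w'' y0 0).continuousAt.tendsto.mono_left nhdsWithin_le_nhds).const_mul C
    refine tendsto_nhds_unique (h2.congr' ?_) h1
    filter_upwards [self_mem_nhdsWithin] with y hy
    have h3 := hw y hy
    rw [hode y hy, hC y hy, riccati]
    field_simp
  have hCz := (mul_eq_zero.1 hC0).resolve_right (w_zero_ne_one h0 hne)
  intro y hy
  rw [hC y hy, hCz, zero_mul]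

lemma riccati_tendsto_zero_right {y0 : ℝ} (h0 : 0 < y0) (f : neumannSpace) :
    Tendsto (fun y => riccati y0 y * (f : ℝ → ℝ) y ^ 2) (𝓝[>] 0)
      (𝓝 (riccati y0 0 * (f : ℝ → ℝ) 0 ^ 2)) := by
  have h1 : Tendsto (f : ℝ → ℝ) (𝓝[>] 0) (𝓝 ((f : ℝ → ℝ) 0)) :=
    (f.2.1.continuousOn 0 self_mem_Ici).tendsto.mono_left (nhdsWithin_mono _ Ioi_subset_Ici_self)
  exact ((hasDerivAt_riccati (y := 0) (by linarith)).continuousAt.tendsto.mono_left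
    nhdsWithin_le_nhds).mul (h1.pow 2)

/-- At zero shift w'(0) = 0, so ρ is singular at 0. Still f/w' is a quotient of slopes tending to
f'(0)/w''(0) = 0, and ρf² = w'' f (f/w'). -/
lemma riccati_zero_tendsto_zero_right (f : neumannSpace) (hf : (f : ℝ → ℝ) 0 = 0) :
    Tendsto (fun y => riccati 0 y * (f : ℝ → ℝ) y ^ 2) (𝓝[>] 0) (𝓝 0) := by
  have hw0 : w 0 0 = 3 / 2 := by simp [w, wc]
  have hw'0 : w' 0 0 = 0 := by simp [w']
  have hf1 : Tendsto (f : ℝ → ℝ) (𝓝[>] 0) (𝓝 0) := by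
    have := (f.2.1.continuousOn 0 self_mem_Ici).tendsto
    rw [hf] at this
    exact this.mono_left (nhdsWithin_mono _ Ioi_subset_Ici_self)
  have hfs : Tendsto (slope (f : ℝ → ℝ) 0) (𝓝[>] 0) (𝓝 0) := by
    have h1 := ((f.2.1.differentiableOn (by norm_num)) 0 self_mem_Ici).hasDerivWithinAt
    have h2 : derivWithin (f : ℝ → ℝ) (Ici 0) 0 = 0 := f.2.2.1
    rw [h2, hasDerivWithinAt_iff_tendsto_slope, Ici_sdiff_left] at h1
    exact h1
  have hws : Tendsto (slope (w' 0) 0) (𝓝[>] 0) (𝓝 (w 0 0 - w 0 0 ^ 2)) := by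
    have h1 := (hasDerivAt_w' 0 0).hasDerivWithinAt (s := Ioi 0)
    rwa [hasDerivWithinAt_iff_tendsto_slope' (by simp)] at h1
  have hquot := hfs.div hws (by rw [hw0]; norm_num)
  have hw2 : Tendsto (fun y => w 0 y - w 0 y ^ 2) (𝓝[>] 0) (𝓝 (w 0 0 - w 0 0 ^ 2)) :=
    (hasDerivAt_w'' 0 0).continuousAt.tendsto.mono_left nhdsWithin_le_nhds
  have h3 := (hw2.mul hf1).mul hquot
  rw [mul_zero, zero_mul] at h3
  refine h3.congr' ?_
  filter_upwards [self_mem_nhdsWithin] with y hy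
  have hy0 : y ≠ 0 := (mem_Ioi.1 hy).ne'
  have h4 : w' 0 y ≠ 0 := (w'_neg (by simpa using hy)).ne
  simp only [Pi.div_apply, slope_def_field, hf, hw'0, sub_zero, riccati]
  field_simp

theorem energy_nonneg_of_apply_zero {y0 : ℝ} (h0 : 0 ≤ y0) (hne : y0 ≠ y0c) (f : neumannSpace)
    (hf : (f : ℝ → ℝ) 0 = 0) :
    0 ≤ energy y0 f f ∧ (energy y0 f f ≤ 0 → ∀ y, 0 < y → (f : ℝ → ℝ) y = 0) := by
  refine energy_nonneg_of_tendsto h0 hne f le_rfl ?_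
  rcases h0.eq_or_lt with rfl | h
  · exact riccati_zero_tendsto_zero_right f hf
  · simpa [hf] using riccati_tendsto_zero_right h f

/-- The half-angle form of w(0) shows that it crosses 1 exactly when cosh y₀ = 2; this decides the
sign of w''(0). -/
lemma w_zero_mul (y0 : ℝ) : w y0 0 * (1 + Real.cosh y0) = 3 := by
  have h1 := Real.cosh_two_mul (y0 / 2)
  rw [Real.sinh_sq, mul_div_cancel₀ _ two_ne_zero] at h1
  have hc : Real.cosh (y0 / 2) ≠ 0 := (Real.cosh_pos _).ne'
  simp only [w, wc, zero_add, h1]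
  field_simp
  ring

lemma y0c_nonneg : 0 ≤ y0c := Real.log_nonneg (by linarith [Real.sqrt_nonneg 3])

lemma cosh_y0c : Real.cosh y0c = 2 := by
  have h3 : √3 ^ 2 = 3 := Real.sq_sqrt (by norm_num)
  have h0 : 0 < 2 + √3 := by positivity
  rw [y0c, Real.cosh_log h0]
  field_simp
  linarith

lemma w_zero_lt_one {y0 : ℝ} (h : y0c < y0) : w y0 0 < 1 := by
  have h1 : 2 < Real.cosh y0 := by
    rw [← cosh_y0c, Real.cosh_lt_cosh, abs_of_nonneg y0c_nonneg]
    exact h.trans_le (le_abs_self _)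
  nlinarith [w_zero_mul y0, w_pos y0 0]

lemma one_lt_w_zero {y0 : ℝ} (h0 : 0 ≤ y0) (h : y0 < y0c) : 1 < w y0 0 := by
  have h1 : Real.cosh y0 < 2 := by
    rw [← cosh_y0c, Real.cosh_lt_cosh, abs_of_nonneg y0c_nonneg, abs_of_nonneg h0]
    exact h
  nlinarith [w_zero_mul y0, w_pos y0 0]

theorem energy_nonneg {y0 : ℝ} (h : y0c < y0) (f : neumannSpace) :
    0 ≤ energy y0 f f ∧ (energy y0 f f ≤ 0 → ∀ y, 0 < y → (f : ℝ → ℝ) y = 0) := by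
  have h0 : 0 < y0 := y0c_nonneg.trans_lt h
  refine energy_nonneg_of_tendsto h0.le h.ne' f ?_ (riccati_tendsto_zero_right h0 f)
  have h1 := w_zero_lt_one h
  have h2 := w_pos y0 0
  refine mul_nonpos_of_nonpos_of_nonneg ?_ (sq_nonneg _)
  exact div_nonpos_of_nonneg_of_nonpos (by nlinarith) (w'_neg (by linarith)).le

end

end ShiftedNLEP

namespace ShiftedNLEP

open MeasureTheory Set Filter Topology
open scoped RealInnerProductSpace

/-! ### Integrability of solutions and definiteness of the nonlocal form -/

noncomputable section

lemma w_le_exp {y0 : ℝ} (h0 : 0 ≤ y0) (y : ℝ) : w y0 y ≤ 6 * Real.exp (-y) := by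
  have h1 : Real.exp (-(y + y0)) ≤ Real.exp (-y) := Real.exp_le_exp.2 (by linarith)
  linarith [w_le y0 y]

lemma w_sq_le_exp {y0 : ℝ} (h0 : 0 ≤ y0) (y : ℝ) : w y0 y ^ 2 ≤ 9 * Real.exp (-y) := by
  nlinarith [w_le_exp h0 y, w_le_three_halves y0 y, w_pos y0 y]

/-- Decaying solutions of `φ'' - φ + 2 w φ = T φ + F`, with `T` accretive and `F` exponentially
small, are square integrable together with two derivatives. -/
theorem memLp_of_accretive {E : Type*} [NormedAddCommGroup E] [InnerProductSpace ℝ E] {y0 : ℝ}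
    (h0 : 0 ≤ y0) {φ F : ℝ → E} (hφ : ContDiffOn ℝ 2 φ (Ici 0)) (ht : Tendsto φ atTop (𝓝 0))
    {T : E → E} {c K : ℝ} (hT : ∀ x, 0 ≤ ⟪x, T x⟫) (hTc : ∀ x, ‖T x‖ ≤ c * ‖x‖)
    (hF : ∀ y, 0 < y → ‖F y‖ ≤ K * Real.exp (-y))
    (heq : ∀ y, 0 < y → L y0 φ y = T (φ y) + F y) :
    MemLp φ 2 (volume.restrict (Ioi 0)) ∧ MemLp (D φ) 2 (volume.restrict (Ioi 0)) ∧
      MemLp (D (D φ)) 2 (volume.restrict (Ioi 0)) := by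
  obtain ⟨C, hC0, hC⟩ := bounded_of_tendsto hφ.continuousOn ht
  have hK : 0 ≤ K := by
    have h1 := (norm_nonneg _).trans (hF 1 one_pos)
    exact nonneg_of_mul_nonneg_left h1 (Real.exp_pos _)
  have hDD : ∀ y, 0 < y → D (D φ) y = φ y - (2 * w y0 y) • φ y + (T (φ y) + F y) := fun y hy => by
    rw [← heq y hy, L]; abel
  -- 12C² absorbs 2w‖φ‖² (as w ≤ 6e^{-y}), CK absorbs ‖φ‖‖F‖, and the last K is the bound on F
  -- itself; 4 comes from 1 + 2w ≤ 4.
  refine memLp_of_decay hφ ht (K := 12 * C ^ 2 + C * K + K) (C := 4 + c) (by positivity) ?_ ?_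
  · intro y hy
    rw [hDD y hy, inner_add_right, inner_sub_right, inner_add_right, real_inner_smul_right,
      real_inner_self_eq_norm_sq]
    have h1 := hT (φ y)
    have h2 := neg_le_of_abs_le (abs_real_inner_le_norm (φ y) (F y))
    have h3 : ‖φ y‖ * ‖F y‖ ≤ C * (K * Real.exp (-y)) :=
      mul_le_mul (hC y hy.le) (hF y hy) (norm_nonneg _) hC0
    have h4 : 2 * w y0 y * ‖φ y‖ ^ 2 ≤ 2 * (6 * Real.exp (-y)) * C ^ 2 := by
      have := w_le_exp h0 y
      have := pow_le_pow_left₀ (norm_nonneg _) (hC y hy.le) 2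
      have := w_nonneg y0 y
      gcongr
    have h5 : 0 ≤ K * Real.exp (-y) := by positivity
    linarith
  · intro y hy
    rw [hDD y hy]
    have h1 := norm_add_le (φ y - (2 * w y0 y) • φ y) (T (φ y) + F y)
    have h2 := norm_sub_le (φ y) ((2 * w y0 y) • φ y)
    have h3 := norm_add_le (T (φ y)) (F y)
    rw [norm_smul, Real.norm_of_nonneg (by linarith [w_nonneg y0 y])] at h2
    have h4 := mul_le_mul_of_nonneg_right (w_le_three_halves y0 y) (norm_nonneg (φ y))
    have h5 : 0 ≤ (12 * C ^ 2 + C * K) * Real.exp (-y) := by positivity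
    linarith [hTc (φ y), hF y hy]

theorem Solves.mem_neumannSpace {y0 : ℝ} (h0 : 0 ≤ y0) {f ψ : ℝ → ℝ} {K : ℝ}
    (hf : ∀ y, 0 < y → ‖f y‖ ≤ K * Real.exp (-y)) (h : Solves y0 f ψ) : ψ ∈ neumannSpace :=
  ⟨h.1.contDiffOn, h.1.neumann, memLp_of_accretive h0 h.1.contDiffOn h.1.decay
    (T := fun _ => 0) (c := 0) (by simp) (by simp) hf fun y hy => by rw [h.2 y hy, zero_add]⟩

lemma norm_w_le {y0 : ℝ} (h0 : 0 ≤ y0) (y : ℝ) (_ : 0 < y) : ‖w y0 y‖ ≤ 6 * Real.exp (-y) := by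
  rw [Real.norm_of_nonneg (w_nonneg _ _)]; exact w_le_exp h0 y

lemma norm_w_sq_le {y0 : ℝ} (h0 : 0 ≤ y0) (y : ℝ) (_ : 0 < y) :
    ‖w y0 y ^ 2‖ ≤ 9 * Real.exp (-y) := by
  rw [Real.norm_of_nonneg (sq_nonneg _)]; exact w_sq_le_exp h0 y

lemma solves_Linv {y0 : ℝ} {f ψ : ℝ → ℝ} (h : Solves y0 f ψ) : Solves y0 f (Linv y0 f) := by
  have h' : ∃ ψ, Solves y0 f ψ := ⟨ψ, h⟩
  rw [Linv, dif_pos h']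
  exact h'.choose_spec

lemma energy_of_L_eq {y0 : ℝ} {f : ℝ → ℝ} (u : neumannSpace)
    (hu : ∀ y, 0 < y → L y0 (u : ℝ → ℝ) y = f y) (x : neumannSpace) :
    energy y0 u x = -∫ y in Ioi (0 : ℝ), f y * (x : ℝ → ℝ) y := by
  rw [energy_symm, ← neg_eq_iff_eq_neg, ← integral_mul_L]
  refine setIntegral_congr_fun measurableSet_Ioi fun y hy => ?_
  simp only [hu y hy]
  ring

theorem intWW_pos (y0 : ℝ) : 0 < intWW y0 := by
  have hi : IntegrableOn (fun y => w y0 y ^ 2) (Ioi 0) := (memLp_w y0).integrable_sq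
  rw [intWW, setIntegral_pos_iff_support_of_nonneg_ae (ae_of_all _ fun y => sq_nonneg _) hi]
  have : Function.support (fun y => w y0 y ^ 2) = univ :=
    eq_univ_of_forall fun y => by simpa using (w_pos y0 y).ne'
  rw [this, univ_inter]
  simp

/-- The explicit solution w - k w' of L ψ = w² is positive, because w' < 0 and k = w'(0)/w''(0) ≥ 0
below the critical shift. Symmetry of the energy transfers the integral from the chosen solution to
this one, so uniqueness is not needed. -/
theorem intWWLinvWW_pos {y0 : ℝ} (h0 : 0 ≤ y0) (h : y0 < y0c) : 0 < intWWLinvWW y0 := by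
  have hs := solves_w_sq h0 h.ne
  have hL := solves_Linv hs
  set v : neumannSpace := ⟨_, hL.mem_neumannSpace h0 (norm_w_sq_le h0)⟩ with hv
  set v' : neumannSpace := ⟨_, hs.mem_neumannSpace h0 (norm_w_sq_le h0)⟩ with hv'
  have h1 := energy_of_L_eq v hL.2 v'
  rw [energy_symm, energy_of_L_eq v' hs.2 v, neg_inj] at h1
  rw [intWWLinvWW]
  change 0 < ∫ y in Ioi (0 : ℝ), w y0 y ^ 2 * (v : ℝ → ℝ) y
  rw [h1]
  have hk : 0 ≤ w' y0 0 / (w y0 0 - w y0 0 ^ 2) := by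
    refine div_nonneg_of_nonpos ?_ ?_
    · have h2 : 0 ≤ Real.sinh (y0 / 2) := Real.sinh_nonneg_iff.2 (by linarith)
      have h3 := Real.cosh_pos (y0 / 2)
      have h4 := w_pos y0 0
      have : 0 ≤ w y0 0 * (Real.sinh (y0 / 2) / Real.cosh (y0 / 2)) := by positivity
      simpa [w'] using this
    · nlinarith [one_lt_w_zero h0 h]
  have hpos : ∀ y, 0 < y → 0 < w y0 y ^ 2 * (v' : ℝ → ℝ) y := fun y hy => by
    have h2 := w_pos y0 y
    have h3 := mul_nonneg hk (neg_nonneg.2 (w'_neg (y0 := y0) (y := y) (by linarith)).le)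
    have h4 : 0 < w y0 y - w' y0 0 / (w y0 0 - w y0 0 ^ 2) * w' y0 y := by linarith
    exact mul_pos (pow_pos h2 2) h4
  have hi : IntegrableOn (fun y => w y0 y ^ 2 * (v' : ℝ → ℝ) y) (Ioi 0) :=
    integrableOn_mul (memLp_w_sq y0) v'.2.2.2.1
  rw [setIntegral_pos_iff_support_of_nonneg_ae
    ((ae_restrict_iff' measurableSet_Ioi).2 (ae_of_all _ fun y hy => (hpos y hy).le)) hi]
  have : Function.support (fun y => w y0 y ^ 2 * (v' : ℝ → ℝ) y) ∩ Ioi 0 = Ioi 0 :=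
    inter_eq_right.2 fun y hy => (hpos y hy).ne'
  rw [this]
  simp

/-- The quadratic form of the symmetrized nonlocal operator. -/
def nonlocalForm (y0 μ : ℝ) (x : neumannSpace) : ℝ :=
  energy y0 x x + μ / intWW y0 * ((∫ y in Ioi (0 : ℝ), w y0 y * (x : ℝ → ℝ) y) *
    ∫ y in Ioi (0 : ℝ), w y0 y ^ 2 * (x : ℝ → ℝ) y)

/-- Positive definiteness of the nonlocal form in the stable range of `μ`. -/
theorem nonlocalForm_posDef {y0 μ : ℝ}
    (h : (0 ≤ y0 ∧ y0 < y0c ∧ mu1 y0 < μ ∧ μ < mu2 y0) ∨ (y0c < y0 ∧ 0 ≤ μ ∧ μ < mu1 y0))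
    (x : neumannSpace) :
    0 ≤ nonlocalForm y0 μ x ∧
      (nonlocalForm y0 μ x = 0 → ∀ y, 0 < y → (x : ℝ → ℝ) y = 0) := by
  have h0 : 0 ≤ y0 := by
    rcases h with h | h
    · exact h.1
    · exact y0c_nonneg.trans h.1.le
  have hne : y0 ≠ y0c := by
    rcases h with h | h
    · exact h.2.1.ne
    · exact h.1.ne'
  have hu := solves_Linv (solves_w h0 hne)
  have hv := solves_Linv (solves_w_sq h0 hne)
  set u : neumannSpace := ⟨_, hu.mem_neumannSpace h0 (norm_w_le h0)⟩ with hudef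
  set v : neumannSpace := ⟨_, hv.mem_neumannSpace h0 (norm_w_sq_le h0)⟩ with hvdef
  have hux := energy_of_L_eq u hu.2
  have hvx := energy_of_L_eq v hv.2
  have ha : energy y0 u u = -intWLinvW y0 := hux u
  have hb : energy y0 u v = -intWLinvWW y0 := hux v
  have hc : energy y0 v v = -intWWLinvWW y0 := hvx v
  have hI := intWW_pos y0
  set s := μ / (2 * intWW y0) with hs
  have hμ : μ = s * (2 * intWW y0) := by rw [hs]; field_simp
  have hQ : nonlocalForm y0 μ x = energy y0 x x + 2 * s * (energy y0 u x * energy y0 v x) := by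
    rw [nonlocalForm, hux, hvx, hs]
    field_simp
  rw [hQ]
  set r := √(intWLinvW y0 * intWWLinvWW y0) with hr
  have hr0 : 0 ≤ r := Real.sqrt_nonneg _
  rcases h with ⟨-, hlt, h1, h2⟩ | ⟨hlt, h1, h2⟩
  · have hc0 := intWWLinvWW_pos h0 hlt
    rw [mu1, ← hr] at h1
    rw [mu2, ← hr] at h2
    have hstab : 0 < 2 * s * intWLinvWW y0 - 1
        - s ^ 2 * (intWLinvWW y0 ^ 2 - intWLinvW y0 * intWWLinvWW y0) := by
      set b := intWLinvWW y0
      have hI2 : 0 < 2 * intWW y0 := by linarith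
      have hlt12 := h1.trans h2
      -- For a negative radicand the square root is 0, so μ₁ = μ₂ and the interval is empty.
      have hac : r ^ 2 = intWLinvW y0 * intWWLinvWW y0 := by
        refine Real.sq_sqrt ?_
        by_contra! hneg
        have : r = 0 := Real.sqrt_eq_zero_of_nonpos hneg.le
        rw [this] at hlt12
        simp at hlt12
      rw [← hac]
      -- Since μ₁ < μ₂, the denominators b ± r have the same strict sign. When a denominator
      -- vanishes, division by zero gives 0, which again contradicts μ₁ < μ₂.
      have key : 0 < (s * (b + r) - 1) * (1 - s * (b - r)) := by
        rw [hμ] at h1 h2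
        rcases lt_trichotomy (b + r) 0 with hbr | hbr | hbr
        · have hbr' : b - r < 0 := by linarith
          rw [div_lt_iff_of_neg hbr] at h1
          rw [lt_div_iff_of_neg hbr'] at h2
          refine mul_pos_of_neg_of_neg ?_ ?_ <;> nlinarith
        · exfalso
          rw [hbr, div_zero] at h1
          have : 2 * intWW y0 / (b - r) ≤ 0 := div_nonpos_of_nonneg_of_nonpos hI2.le (by linarith)
          linarith
        · have hbr' : 0 < b - r := by
            by_contra! hle
            have h3 : 2 * intWW y0 / (b - r) ≤ 0 := div_nonpos_of_nonneg_of_nonpos hI2.le hle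
            have h4 : 0 < 2 * intWW y0 / (b + r) := by positivity
            linarith
          rw [div_lt_iff₀ hbr] at h1
          rw [lt_div_iff₀ hbr'] at h2
          refine mul_pos ?_ ?_ <;> nlinarith
      linarith
    set l : neumannSpace →ₗ[ℝ] ℝ :=
      (LinearMap.proj (0 : ℝ) : (ℝ → ℝ) →ₗ[ℝ] ℝ) ∘ₗ neumannSpace.subtype
    have hp := lorentzian_perturbation (energy y0) (energy_symm y0) l
      (fun z hz => (energy_nonneg_of_apply_zero h0 hne z hz).1) u v ha hb hc hc0 hstab x
    refine ⟨hp.1, fun hz => ?_⟩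
    obtain ⟨h3, h4⟩ := hp.2 hz
    exact (energy_nonneg_of_apply_zero h0 hne x h3).2 h4
  · have hs0 : 0 ≤ s := by positivity
    have hp := positive_perturbation (energy y0) (energy_symm y0)
      (fun z => (energy_nonneg hlt z).1) u v ha hb hc hs0 x
    rw [← hr] at hp
    obtain ⟨he, he0⟩ := energy_nonneg hlt x
    have hδ : 0 < 1 - s * (intWLinvWW y0 + r) := by
      rw [mu1, ← hr] at h2
      -- A nonpositive denominator would give μ₁ ≤ 0, against 0 ≤ μ < μ₁.
      have hbr : 0 < intWLinvWW y0 + r := by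
        by_contra! hle
        have h3 : 2 * intWW y0 / (intWLinvWW y0 + r) ≤ 0 :=
          div_nonpos_of_nonneg_of_nonpos (by linarith) hle
        linarith
      rw [lt_div_iff₀ hbr, hμ] at h2
      nlinarith
    refine ⟨(mul_nonneg hδ.le he).trans hp, fun hz => he0 ?_⟩
    rw [hz] at hp
    exact nonpos_of_mul_nonpos_right hp hδ

/-! ### Real and imaginary parts -/

section Components

variable {φ : ℝ → ℂ} (l : ℂ →L[ℝ] ℝ)

lemma D_clm_comp (hφ : ContDiffOn ℝ 1 φ (Ici 0)) {y : ℝ} (hy : 0 ≤ y) :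
    D (fun z => l (φ z)) y = l (D φ y) :=
  (l.hasFDerivAt.comp_hasDerivWithinAt y
    (hφ.differentiableOn (by norm_num) y hy).hasDerivWithinAt).derivWithin
      ((uniqueDiffOn_Ici 0) y hy)

lemma DD_clm_comp (hφ : ContDiffOn ℝ 2 φ (Ici 0)) {y : ℝ} (hy : 0 ≤ y) :
    D (D (fun z => l (φ z))) y = l (D (D φ) y) := by
  have h : EqOn (D (fun z => l (φ z))) (fun z => l (D φ z)) (Ici 0) :=
    fun z hz => D_clm_comp l (hφ.of_le (by norm_num)) hz
  rw [D_congr h hy, D_clm_comp l (contDiffOn_D hφ) hy]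

lemma L_clm_comp (y0 : ℝ) (hφ : ContDiffOn ℝ 2 φ (Ici 0)) {y : ℝ} (hy : 0 ≤ y) :
    L y0 (fun z => l (φ z)) y = l (L y0 φ y) := by
  rw [L, L, DD_clm_comp l hφ hy, map_add, map_sub, map_smul]

lemma clm_comp_mem_neumannSpace (hφ : ContDiffOn ℝ 2 φ (Ici 0)) (hN : D φ 0 = 0)
    (h : MemLp φ 2 (volume.restrict (Ioi 0)) ∧ MemLp (D φ) 2 (volume.restrict (Ioi 0)) ∧
      MemLp (D (D φ)) 2 (volume.restrict (Ioi 0))) : (fun z => l (φ z)) ∈ neumannSpace := by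
  refine ⟨l.contDiff.comp_contDiffOn hφ, ?_, l.comp_memLp' h.1,
    memLp_congr_Ioi (l.comp_memLp' h.2.1) fun y hy => ?_,
    memLp_congr_Ioi (l.comp_memLp' h.2.2) fun y hy => ?_⟩
  · rw [D_clm_comp l (hφ.of_le (by norm_num)) le_rfl, hN, map_zero]
  · exact D_clm_comp l (hφ.of_le (by norm_num)) hy.le
  · exact DD_clm_comp l hφ hy.le

end Components

/-! ### Testing the eigenvalue equation -/

lemma inner_self_mul_nonneg {lam : ℂ} (h : 0 ≤ lam.re) (x : ℂ) : 0 ≤ ⟪x, lam * x⟫ := by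
  rw [Complex.inner]
  simp only [Complex.mul_re, Complex.mul_im, Complex.conj_re, Complex.conj_im]
  nlinarith [mul_nonneg h (sq_nonneg x.re), mul_nonneg h (sq_nonneg x.im)]

/-- Testing the eigenvalue equation with the eigenfunction gives minus the nonlocal form. -/
theorem nonlocalForm_add_nonpos {y0 μ α β mR mI : ℝ} (hα : 0 ≤ α) (f g : neumannSpace)
    (hmR : mR = ∫ y in Ioi (0 : ℝ), w y0 y * (f : ℝ → ℝ) y)
    (hmI : mI = ∫ y in Ioi (0 : ℝ), w y0 y * (g : ℝ → ℝ) y)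
    (hf : ∀ y, 0 < y → L y0 (f : ℝ → ℝ) y - μ / intWW y0 * mR * w y0 y ^ 2 =
      α * (f : ℝ → ℝ) y - β * (g : ℝ → ℝ) y)
    (hg : ∀ y, 0 < y → L y0 (g : ℝ → ℝ) y - μ / intWW y0 * mI * w y0 y ^ 2 =
      α * (g : ℝ → ℝ) y + β * (f : ℝ → ℝ) y) :
    nonlocalForm y0 μ f + nonlocalForm y0 μ g ≤ 0 := by
  set k := μ / intWW y0 with hk
  have i1 := integrableOn_mul_L y0 f f
  have i2 := integrableOn_mul_L y0 g g
  have i3 := integrableOn_mul (memLp_w_sq y0) f.2.2.2.1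
  have i4 := integrableOn_mul (memLp_w_sq y0) g.2.2.2.1
  have key : ∫ y in Ioi (0 : ℝ), (((f : ℝ → ℝ) y * L y0 (f : ℝ → ℝ) y +
      (g : ℝ → ℝ) y * L y0 (g : ℝ → ℝ) y) - (k * mR * (w y0 y ^ 2 * (f : ℝ → ℝ) y) +
      k * mI * (w y0 y ^ 2 * (g : ℝ → ℝ) y))) =
      ∫ y in Ioi (0 : ℝ), α * ((f : ℝ → ℝ) y ^ 2 + (g : ℝ → ℝ) y ^ 2) := by
    refine setIntegral_congr_fun measurableSet_Ioi fun y hy => ?_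
    -- The rotation terms ∓βfg cancel, so only α = Re λ survives.
    linear_combination (f : ℝ → ℝ) y * hf y hy + (g : ℝ → ℝ) y * hg y hy
  have hnn : 0 ≤ ∫ y in Ioi (0 : ℝ), α * ((f : ℝ → ℝ) y ^ 2 + (g : ℝ → ℝ) y ^ 2) :=
    integral_nonneg fun y => by positivity
  have e1 := integral_sub (i1.add i2) ((i3.const_mul (k * mR)).add (i4.const_mul (k * mI)))
  simp only [Pi.add_apply] at e1
  rw [integral_add i1 i2, integral_add (i3.const_mul (k * mR)) (i4.const_mul (k * mI)),
    integral_const_mul, integral_const_mul, integral_mul_L, integral_mul_L] at e1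
  rw [← key, e1] at hnn
  simp only [nonlocalForm, ← hk, ← hmR, ← hmI]
  linarith

theorem IsEigenvalue.re_neg {y0 μ : ℝ}
    (h : (0 ≤ y0 ∧ y0 < y0c ∧ mu1 y0 < μ ∧ μ < mu2 y0) ∨ (y0c < y0 ∧ 0 ≤ μ ∧ μ < mu1 y0))
    {lam : ℂ} (hlam : IsEigenvalue y0 μ lam) : lam.re < 0 := by
  by_contra! hre
  obtain ⟨φ, hφ, ⟨y, hy, hφy⟩, heq⟩ := hlam
  have h0 : 0 ≤ y0 := by
    rcases h with h | h
    · exact h.1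
    · exact y0c_nonneg.trans h.1.le
  set m : ℂ := ∫ z in Ioi (0 : ℝ), (w y0 z : ℂ) * φ z with hm
  set κ : ℂ := (μ : ℂ) * (m / (intWW y0 : ℂ)) with hκ
  -- Multiplication by λ is accretive because Re λ ≥ 0; the nonlocal term is the exponentially small
  -- forcing.
  have hmem := memLp_of_accretive h0 hφ.contDiffOn hφ.decay (T := fun x => lam * x) (c := ‖lam‖)
    (F := fun y => κ * (w y0 y : ℂ) ^ 2) (K := ‖κ‖ * 9) (inner_self_mul_nonneg hre)
    (fun x => (norm_mul lam x).le) (fun y hy => by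
      rw [norm_mul, norm_pow, Complex.norm_real, ← norm_pow, mul_assoc]
      exact mul_le_mul_of_nonneg_left (norm_w_sq_le h0 y hy) (norm_nonneg _))
    (fun y hy => by rw [← heq y hy]; ring)
  set f : neumannSpace :=
    ⟨_, clm_comp_mem_neumannSpace Complex.reCLM hφ.contDiffOn hφ.neumann hmem⟩
  set g : neumannSpace :=
    ⟨_, clm_comp_mem_neumannSpace Complex.imCLM hφ.contDiffOn hφ.neumann hmem⟩
  have hi : IntegrableOn (fun z => (w y0 z : ℂ) * φ z) (Ioi 0) :=
    ((memLp_w y0).ofReal (K := ℂ)).integrable_mul hmem.1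
  have hmR : m.re = ∫ y in Ioi (0 : ℝ), w y0 y * (f : ℝ → ℝ) y := by
    refine (Complex.reCLM.integral_comp_comm hi).symm.trans ?_
    congr 1
    funext z
    exact Complex.re_ofReal_mul _ _
  have hmI : m.im = ∫ y in Ioi (0 : ℝ), w y0 y * (g : ℝ → ℝ) y := by
    refine (Complex.imCLM.integral_comp_comm hi).symm.trans ?_
    congr 1
    funext z
    exact Complex.im_ofReal_mul _ _
  have hκ' : ∀ y, κ * (w y0 y : ℂ) ^ 2 = ((μ / intWW y0 * w y0 y ^ 2 : ℝ) : ℂ) * m := fun y => by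
    rw [hκ]; push_cast; ring
  have hsum := nonlocalForm_add_nonpos (μ := μ) (β := lam.im) hre f g hmR hmI
    (fun y hy => by
      have h1 := congrArg Complex.re (heq y hy)
      rw [hκ', Complex.sub_re, Complex.re_ofReal_mul, Complex.mul_re] at h1
      have h2 := L_clm_comp Complex.reCLM y0 hφ.contDiffOn hy.le
      change L y0 (fun z => Complex.reCLM (φ z)) y - _ = lam.re * (φ y).re - lam.im * (φ y).im
      rw [h2, Complex.reCLM_apply, ← h1]
      ring)
    (fun y hy => by
      have h1 := congrArg Complex.im (heq y hy)
      rw [hκ', Complex.sub_im, Complex.im_ofReal_mul, Complex.mul_im] at h1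
      have h2 := L_clm_comp Complex.imCLM y0 hφ.contDiffOn hy.le
      change L y0 (fun z => Complex.imCLM (φ z)) y - _ = lam.re * (φ y).im + lam.im * (φ y).re
      rw [h2, Complex.imCLM_apply, ← h1]
      ring)
  obtain ⟨f1, f2⟩ := nonlocalForm_posDef h f
  obtain ⟨g1, g2⟩ := nonlocalForm_posDef h g
  have hzero : ∀ y, 0 < y → φ y = 0 := fun y hy =>
    Complex.ext (f2 (by linarith) y hy) (g2 (by linarith) y hy)
  -- The equation holds only for y > 0; the endpoint is reached by continuity.
  rcases hy.eq_or_lt with rfl | hy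
  · have h1 : Tendsto φ (𝓝[>] 0) (𝓝 (φ 0)) :=
      (hφ.contDiffOn.continuousOn 0 self_mem_Ici).tendsto.mono_left
        (nhdsWithin_mono _ Ioi_subset_Ici_self)
    refine hφy (tendsto_nhds_unique h1 (tendsto_const_nhds.congr' ?_))
    filter_upwards [self_mem_nhdsWithin] with z hz
    exact (hzero z hz).symm
  · exact hφy (hzero y hy)

end

end ShiftedNLEP

theorem theorem3p6 (y0 μ : ℝ)
    (h : (0 ≤ y0 ∧ y0 < ShiftedNLEP.y0c ∧ ShiftedNLEP.mu1 y0 < μ ∧ μ < ShiftedNLEP.mu2 y0) ∨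
      (ShiftedNLEP.y0c < y0 ∧ 0 ≤ μ ∧ μ < ShiftedNLEP.mu1 y0))
    (lam : ℂ) (hlam : ShiftedNLEP.IsEigenvalue y0 μ lam) :
    lam.re < 0 := by
  exact hlam.re_neg h
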